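/- **Setting.** Let $1/2<\beta<1$, $c_\gamma>0$, $a>1/2$, $0<\tau_0<\tau_1<1$, and let $c_L,c_f,M>0$ and $c_y$ be constants. Let $W_t=(X_{1,t},\dots,X_{p,t})^\top$, $t=1,2,\dots$, be i.i.d. random vectors in $\mathbb R^p$. Put $\rho_\tau(u)=u(\tau-\mathbf 1_{\{u<0\}})$, and let $Q_i(\tau)$ be the $\tau$-quantile of $X_{i,1}$, i.e. the minimizer over $x\in\mathbb R$ of the expected loss $\mathbb E\,\rho_\tau(X_{i,1}-x)$ (in the sense that $\mathbb E[\rho_\tau(X_{i,1}-Q_i(\tau))-\rho_\tau(X_{i,1}-x)]\le 0$ for all $x$, which needs no moment of $X_{i,1}$). Assume that for every $1\le i\le p$ the variable $X_{i,1}$ has a differentiable density $f_i$ with $\sup_x|f_i(x)|\le c_f$ and $\sup_x|f_i'(x)|\le c_f$, that $f_i(Q_i(\tau))\ge c_L$ and $|Q_i(\tau)|\le M$ for all $\tau\in[\tau_0,\tau_1]$, and that the initial values $y_i\in\mathbb R$ satisfy $|y_i|\le c_y$. Let $g(x)=1$ for $x\ge1$, $g(x)=(x+1)/2$ for $-1\le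 x<1$, $g(x)=0$ for $x<-1$; let $g_h(x)=g(x/h)$ and $\gamma_k=c_\gamma k^{-\beta}$. Define the smoothed SGD iterates by $Y_{i,1}(\tau)=y_i$ and $$Y_{i,k+1}(\tau)=Y_{i,k}(\tau)+\gamma_k\big(\tau-g_{a\gamma_k}(Y_{i,k}(\tau)-X_{i,k+1})\big),\qquad k\ge1,$$ and their averages by $\bar Y_{i,n}(\tau)=n^{-1}\sum_{k=1}^nY_{i,k}(\tau)$. **Theorem.** There are positive constants $C,b_1,\dots,b_{10}$, depending only on $\beta,c_\gamma,a,\tau_0,\tau_1,c_L,c_f,M,c_y$ (in particular not on $i,\tau,n,p,x$), such that for all $n\ge1$ and $x>0$ the following hold. For all $1\le i\le p$ and $\tau\in[\tau_0,\tau_1]$, $$\mathbb P\big(|\bar Y_{i,n}(\tau)-Q_i(\tau)|>x\big)\le C\Big\{e^{-b_1nx^2}+n\,e^{-b_2n^\beta x}+n^{2+\beta}e^{-b_3n^{\beta(1-\beta)}x^{1/4}}+\min\big\{n^{2+\beta}e^{-b_4n^{(\beta+1/2)(1-\beta)}x^{1/2}},\ n^{1+\beta}e^{-b_5n^{1-\beta^2}x}\big\}\Big\},$$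 and, uniformly in $i$ and $\tau$, $$\mathbb P\Big(\max_{1\le i\le p}\sup_{\tau_0\le\tau\le\tau_1}|\bar Y_{i,n}(\tau)-Q_i(\tau)|>x\Big)\le C\,\frac px\Big\{e^{-b_6nx^2}+n\,e^{-b_7n^\beta x}+n^{2+\beta}e^{-b_8n^{\beta(1-\beta)}x^{1/4}}+\min\big\{n^{2+\beta}e^{-b_9n^{(\beta+1/2)(1-\beta)}x^{1/2}},\ n^{1+\beta}e^{-b_{10}n^{1-\beta^2}x}\big\}\Big\}.$$ -/

import Mathlib

open MeasureTheory ProbabilityTheory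

noncomputable section

/-- The quantile loss (check function) `ρ_τ(u) = u (τ - 1_{u < 0})`. -/
def quantileLoss (τ u : ℝ) : ℝ :=
  u * (τ - if u < 0 then 1 else 0)

/-- `q` is a `τ`-quantile of the real random variable `X`: it minimizes the expected quantile loss
`x ↦ E ρ_τ(X - x)`. The comparison of `q` with a competitor `y` is written as
`E[ρ_τ(X - q) - ρ_τ(X - y)] ≤ 0`. The integrand is bounded by `|q - y|`, so the expectation always
exists, and for integrable `X` this says precisely `E ρ_τ(X - q) ≤ E ρ_τ(X - y)`. -/
def IsQuantile {Ω : Type*} [MeasurableSpace Ω] (μ : Measure Ω) (X : Ω → ℝ) (τ q : ℝ) : Prop :=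
  ∀ y : ℝ, ∫ ω, (quantileLoss τ (X ω - q) - quantileLoss τ (X ω - y)) ∂μ ≤ 0

/-- The piecewise linear function that replaces the indicator of `[0, ∞)`. -/
def smoothStep (x : ℝ) : ℝ :=
  if 1 ≤ x then 1 else if -1 ≤ x then (x + 1) / 2 else 0

/-- The rescaled function `g_h(x) = g(x / h)`. -/
def smoothStepScaled (h x : ℝ) : ℝ :=
  smoothStep (x / h)

/-- The learning rate `γ_k = c_γ k^{-β}`, for `k ≥ 1`. -/
def learningRate (cγ β : ℝ) (k : ℕ) : ℝ :=
  cγ * (k : ℝ) ^ (-β)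

/-- The smoothed SGD recursion driven by the data `x`: `Y_1 = y` and
`Y_{k+1} = Y_k + γ_k (τ - g_{a γ_k}(Y_k - x_{k+1}))` for `k ≥ 1`.
The value at index `0` is a dummy that is never used. -/
def smoothedSGD (cγ β a τ y : ℝ) (x : ℕ → ℝ) : ℕ → ℝ
  | 0 => y
  | 1 => y
  | k + 2 =>
    smoothedSGD cγ β a τ y x (k + 1) + learningRate cγ β (k + 1) *
      (τ - smoothStepScaled (a * learningRate cγ β (k + 1))
        (smoothedSGD cγ β a τ y x (k + 1) - x (k + 2)))

/-- The Polyak–Ruppert average `n⁻¹ ∑_{k=1}^n Y_k` of the smoothed SGD iterates. -/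
def averagedSGD (cγ β a τ y : ℝ) (x : ℕ → ℝ) (n : ℕ) : ℝ :=
  (∑ k ∈ Finset.Icc 1 n, smoothedSGD cγ β a τ y x k) / n

end

/-!
The proof linearizes the recursion at the quantile `q = Q_i(τ)`. Write `D_k = Y_k - q`, let `F` be
the distribution function, `F_h(y) = E g_h(y - X)` its smoothed version and
`ξ_k = F_h(Y_k) - g_h(Y_k - X_{k+1})` the (bounded, conditionally centred) noise. Since `F` has a
bounded density with bounded derivative, `F_h(Y_k) - τ = f(q) D_k + O(D_k² + γ_k)`, and hence
`f(q) D_k = (D_k - D_{k+1}) / γ_k + ξ_k + O(D_k² + γ_k)`. Summing over `k ≤ n` and summing the first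
term by parts (`abs_averagedSGD_sub_le`) bounds `n |Ȳ_n - q|` by the noise sum, by
`∑ k^(β-1) |D_k| + n^β |D_{n+1}|`, by `∑ D_k²` and by a bias of order `n^(1-β)`. Azuma's inequality
(`measureReal_sum_noise_le`) controls the noise sum and produces the term `exp(-b n x²)`.

The other sums need tails for a single iterate, `exists_tail_bound`:
`P(|D_k| > u) ≤ C (k exp(-b k^β u²) + exp(-b k^β))`. This is proved for `IsDriftProcess`, an
abstraction that covers `D` and `-D` at once, by decomposing paths at a last visit to a level. To
exceed a constant level at time `k` a path must either beat a drift bounded below since time `ε k`,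
or climb by a constant amount after its last visit to half the level (`tail_of_steps`). Within the
region where the drift is linear, the path contracts with a deterministic rate after its last visit
to `0`, so that only a geometrically weighted noise sum matters (`tail_of_contraction`).

A union bound (`measureReal_averagedSGD_le`) then asks `|D_k| ≤ ρ (n / k)^(β/2)` for all
`k > z = η √(n x)`, with `ρ` a small multiple of `min (x n^(1-β)) √x`. The iterates up to time `z`
contribute little by the deterministic growth `|D_k| = O(k^(1-β))`. The failure probabilities
are, up to powers of `n`, `exp(-b x² n^(2-β))`, `exp(-b n^β x)` and `exp(-b z^β)`; here `z^β` dominates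
`n^(β(1-β)) x^(1/4)` as soon as `n x² ≥ 1`, which may be assumed. Thus the first three terms of the
bound already suffice; the nonnegative minimum is added at the end.

For the supremum over `τ`, both `Ȳ_n(τ)` and `Q(τ)` are monotone in `τ` (for `Ȳ_n` this is where
`a > 1/2` enters), and `Q` is Lipschitz, so that a grid with `O(1 + 1/x)` points suffices. The
factor `x + 1` that this produces besides `1/x` is absorbed by the exponentials.
-/

/-! ### Elementary estimates for powers, learning rates and recursions -/

lemma exists_rpow_le_mul_exp {b : ℝ} (hb : 0 < b) (r : ℝ) :
    ∃ C : ℝ, 1 ≤ C ∧ ∀ y : ℝ, 0 < y → 1 ≤ y ∨ 0 ≤ r → y ^ r ≤ C * Real.exp (b * y) := by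
  obtain ⟨N, hN⟩ := exists_nat_ge r
  have hC : 0 ≤ (N.factorial : ℝ) / b ^ N := by positivity
  refine ⟨1 + N.factorial / b ^ N, by linarith, fun y hy hr => ?_⟩
  have h1 : 1 ≤ Real.exp (b * y) := Real.one_le_exp (by positivity)
  rcases le_total y 1 with h | h
  · have : y ^ r ≤ 1 := by
      rcases hr with hr | hr
      · rw [le_antisymm h hr, Real.one_rpow]
      · exact Real.rpow_le_one hy.le h hr
    nlinarith
  · have h2 : y ^ r ≤ y ^ N := by
      rw [← Real.rpow_natCast]
      exact Real.rpow_le_rpow_of_exponent_le h hN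
    have h3 := Real.pow_div_factorial_le_exp (b * y) (by positivity) N
    have h4 : y ^ N = (N.factorial / b ^ N) * ((b * y) ^ N / N.factorial) := by
      rw [mul_pow]; field_simp
    nlinarith [mul_le_mul_of_nonneg_left h3 hC]

lemma exists_natCast_rpow_le_mul_exp {b q : ℝ} (hb : 0 < b) (hq : 0 < q) (r : ℝ) :
    ∃ C : ℝ, 1 ≤ C ∧ ∀ k : ℕ, 1 ≤ k → (k : ℝ) ^ r ≤ C * Real.exp (b * (k : ℝ) ^ q) := by
  obtain ⟨C, hC, h⟩ := exists_rpow_le_mul_exp hb (r / q)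
  refine ⟨C, hC, fun k hk => ?_⟩
  have hk' : (1 : ℝ) ≤ k := by exact_mod_cast hk
  have := h ((k : ℝ) ^ q) (by positivity) (Or.inl (Real.one_le_rpow hk' hq.le))
  rwa [← Real.rpow_mul (by positivity), mul_div_cancel₀ _ hq.ne'] at this

lemma sum_Icc_rpow_neg_le {s : ℝ} (hs : 0 < s) (hs' : s < 1) (n : ℕ) :
    ∑ k ∈ Finset.Icc 1 n, (k : ℝ) ^ (-s) ≤ (n : ℝ) ^ (1 - s) / (1 - s) := by
  have h1s : 0 < 1 - s := by linarith
  induction n with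
  | zero => simp [Real.zero_rpow h1s.ne']
  | succ n ih =>
    rw [Finset.sum_Icc_succ_top (by omega)]
    have hp : (0 : ℝ) < (n + 1 : ℕ) := by positivity
    -- Bernoulli's inequality for the concave power `1 - s`
    have hb : (1 + (-1 / ((n + 1 : ℕ) : ℝ))) ^ (1 - s) ≤ 1 + (1 - s) * (-1 / ((n + 1 : ℕ) : ℝ)) := by
      apply rpow_one_add_le_one_add_mul_self _ h1s.le (by linarith)
      rw [neg_div, neg_le_neg_iff, div_le_one hp]
      exact_mod_cast Nat.succ_le_succ (Nat.zero_le n)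
    have he : (1 + (-1 / ((n + 1 : ℕ) : ℝ))) = n / ((n + 1 : ℕ) : ℝ) := by
      field_simp; push_cast; ring
    rw [he, Real.div_rpow (by positivity) hp.le, div_le_iff₀ (by positivity)] at hb
    have hx : ((n + 1 : ℕ) : ℝ) ^ (-s) = ((n + 1 : ℕ) : ℝ) ^ (1 - s) / ((n + 1 : ℕ) : ℝ) := by
      rw [← Real.rpow_sub_one hp.ne']; ring_nf
    rw [hx]
    calc _ ≤ (n : ℝ) ^ (1 - s) / (1 - s) + ((n + 1 : ℕ) : ℝ) ^ (1 - s) / ((n + 1 : ℕ) : ℝ) := by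
          gcongr
      _ ≤ (1 + (1 - s) * (-1 / ((n + 1 : ℕ) : ℝ))) * ((n + 1 : ℕ) : ℝ) ^ (1 - s) / (1 - s)
          + ((n + 1 : ℕ) : ℝ) ^ (1 - s) / ((n + 1 : ℕ) : ℝ) := by gcongr
      _ = _ := by field_simp; ring

lemma learningRate_pos {cγ β : ℝ} (hc : 0 < cγ) {k : ℕ} (hk : 1 ≤ k) :
    0 < learningRate cγ β k := by
  have : (0 : ℝ) < k := by exact_mod_cast hk
  unfold learningRate; positivity

lemma learningRate_le {cγ β : ℝ} (hc : 0 < cγ) (hβ : 0 < β) {s : ℝ} (hs : 0 < s) {k : ℕ}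
    (hk : s ≤ k) : learningRate cγ β k ≤ cγ * s ^ (-β) := by
  unfold learningRate
  exact mul_le_mul_of_nonneg_left (Real.rpow_le_rpow_of_nonpos hs hk (neg_nonpos.2 hβ.le)) hc.le

lemma learningRate_anti {cγ β : ℝ} (hc : 0 < cγ) (hβ : 0 < β) {i k : ℕ} (hi : 1 ≤ i)
    (hk : i ≤ k) : learningRate cγ β k ≤ learningRate cγ β i :=
  learningRate_le hc hβ (by exact_mod_cast hi) (by exact_mod_cast hk)

/-- A sequence that ends above the level `v` either stays above it from time `s` on, or has a last
time at or below it. -/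
lemma above_or_exists_last_le (D : ℕ → ℝ) (v : ℝ) {s k : ℕ} (hsk : s ≤ k) (hk : v < D k) :
    (∀ i, s ≤ i → i ≤ k → v < D i) ∨
      ∃ j ∈ Finset.Ico s k, D j ≤ v ∧ ∀ i, j + 1 ≤ i → i ≤ k → v < D i := by
  induction k, hsk using Nat.le_induction with
  | base =>
    left
    intro i h1 h2
    rwa [le_antisymm h2 h1]
  | succ k hsk ih =>
    by_cases h : D k ≤ v
    · right
      refine ⟨k, by simp [hsk], h, fun i h1 h2 => ?_⟩
      rwa [le_antisymm h2 h1]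
    · rcases ih (not_le.1 h) with h' | ⟨j, hj, hj', hj''⟩
      · left
        intro i h1 h2
        rcases Nat.lt_or_ge k i with h3 | h3
        · rwa [le_antisymm h2 h3]
        · exact h' i h1 h3
      · right
        refine ⟨j, ?_, hj', fun i h1 h2 => ?_⟩
        · simp only [Finset.mem_Ico] at hj ⊢; omega
        · rcases Nat.lt_or_ge k i with h3 | h3
          · rwa [le_antisymm h2 h3]
          · exact hj'' i h1 h3

lemma le_of_linear_recursion {D e : ℕ → ℝ} {r : ℝ} (hr : 0 ≤ r) {j k : ℕ} (hjk : j ≤ k)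
    (h : ∀ i, j ≤ i → i < k → D (i + 1) ≤ r * D i + e i) :
    D k ≤ r ^ (k - j) * D j + ∑ i ∈ Finset.Ico j k, r ^ (k - 1 - i) * e i := by
  induction k, hjk using Nat.le_induction with
  | base => simp
  | succ k hjk ih =>
    have h1 := ih fun i h1 h2 => h i h1 (by omega)
    have h2 := h k hjk (by omega)
    rw [Finset.sum_Ico_succ_top hjk, Nat.succ_sub hjk, pow_succ]
    have h3 : ∑ i ∈ Finset.Ico j k, r ^ (k + 1 - 1 - i) * e i
        = r * ∑ i ∈ Finset.Ico j k, r ^ (k - 1 - i) * e i := by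
      rw [Finset.mul_sum]
      refine Finset.sum_congr rfl fun i hi => ?_
      have : k + 1 - 1 - i = (k - 1 - i) + 1 := by simp only [Finset.mem_Ico] at hi; omega
      rw [this, pow_succ]; ring
    rw [h3]
    simp only [Nat.add_sub_cancel, Nat.sub_self, pow_zero, one_mul]
    nlinarith [mul_le_mul_of_nonneg_left h1 hr]

lemma sum_Ico_pow_le {r : ℝ} (hr : 0 ≤ r) (hr' : r < 1) (j k : ℕ) :
    ∑ i ∈ Finset.Ico j k, r ^ (k - 1 - i) ≤ (1 - r)⁻¹ := by
  have h1 : 0 < 1 - r := by linarith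
  calc _ ≤ ∑ i ∈ Finset.range k, r ^ (k - 1 - i) := by
        refine Finset.sum_le_sum_of_subset_of_nonneg ?_ fun _ _ _ => by positivity
        intro i; simp
    _ = ∑ i ∈ Finset.range k, r ^ i := Finset.sum_range_reflect (fun i => r ^ i) k
    _ ≤ _ := by
      rw [← tsum_geometric_of_lt_one hr hr']
      exact (summable_geometric_of_lt_one hr hr').sum_le_tsum _ fun _ _ => by positivity

/-! ### Drift processes: pathwise decompositions -/

/-- A process `D` (indexed from time `1`) with steps of size at most the learning rate which, while
positive, is pushed down with strength `θ min(D, δ)`, up to a bias of the order of the learning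
rate and a noise `ξ` whose weighted sums are sub-Gaussian. Both `Y - Q` and `Q - Y` are of this
kind for the smoothed SGD `Y`. -/
structure IsDriftProcess {Ω : Type*} [MeasurableSpace Ω] (μ : Measure Ω) (β cγ θ δ B R : ℝ)
    (D ξ : ℕ → Ω → ℝ) : Prop where
  step : ∀ ω i, 1 ≤ i → D (i + 1) ω ≤ D i ω + learningRate cγ β i
  drift : ∀ ω i, 1 ≤ i → 0 < D i ω → D (i + 1) ω ≤ D i ω
    - learningRate cγ β i * (θ * min (D i ω) δ - B * learningRate cγ β i)
    + learningRate cγ β i * ξ i ω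
  growth : ∀ ω i, 1 ≤ i → D i ω ≤ R * (i : ℝ) ^ (1 - β)
  conc : ∀ (w : ℕ → ℝ) (j k : ℕ) (v t : ℝ), 1 ≤ j → 0 < v → 0 ≤ t →
    ∑ i ∈ Finset.Ico j k, w i ^ 2 ≤ v →
    μ.real {ω | t ≤ ∑ i ∈ Finset.Ico j k, w i * ξ i ω} ≤ Real.exp (-(t ^ 2 / (2 * v)))

lemma measureReal_biUnion_Ico_le {Ω : Type*} [MeasurableSpace Ω] (μ : Measure Ω) {s k : ℕ}
    {A : ℕ → Set Ω} {c : ℝ} (h : ∀ j, s ≤ j → j < k → μ.real (A j) ≤ c) :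
    μ.real (⋃ j ∈ Finset.Ico s k, A j) ≤ (k - s : ℕ) * c := by
  refine (measureReal_biUnion_finset_le _ _).trans ?_
  refine (Finset.sum_le_card_nsmul _ _ c fun j hj => ?_).trans (by simp)
  simp only [Finset.mem_Ico] at hj
  exact h j hj.1 hj.2

/-- The crossing estimate at the fixed level `δ`, with the constants left free: a process above `δ`
at time `k` either stayed above `δ / 2` since time `s`, against a drift bounded below, or climbed
from `δ / 2` to `δ` after its last visit below `δ / 2`. -/
lemma IsDriftProcess.tail_of_steps {Ω : Type*} [MeasurableSpace Ω] {μ : Measure Ω}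
    [IsProbabilityMeasure μ] {β cγ θ δ B R : ℝ} {D ξ : ℕ → Ω → ℝ}
    (hP : IsDriftProcess μ β cγ θ δ B R D ξ)
    (hβ : 0 < β) (hcγ : 0 < cγ) (hθ : 0 < θ) (hδ : 0 < δ) (hB : 0 < B)
    {s k : ℕ} {g d S : ℝ} (hs : 1 ≤ s) (hsk : s < k) (hg : learningRate cγ β s ≤ g) (hgp : 0 < g)
    (hd : d = θ * δ / 4) (hg1 : g ≤ δ / 4) (hg2 : B * g ≤ d)
    (hS : S ≤ ∑ i ∈ Finset.Ico s k, learningRate cγ β i) (hS0 : 0 ≤ S)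
    (hR : R * (s : ℝ) ^ (1 - β) ≤ d * S / 2) :
    μ.real {ω | δ < D k ω} ≤ Real.exp (-((d * S / 2) ^ 2 / (2 * (k * g ^ 2))))
      + k * Real.exp (-(δ * d / (8 * g))) := by
  have hdp : 0 < d := by rw [hd]; positivity
  have hγ : ∀ i, s ≤ i → 0 < learningRate cγ β i ∧ learningRate cγ β i ≤ g := fun i hi =>
    ⟨learningRate_pos hcγ (hs.trans hi), (learningRate_anti hcγ hβ hs hi).trans hg⟩
  -- above the level `δ / 2` the drift is at least `d`
  have hdown : ∀ ω i, s ≤ i → δ / 2 < D i ω →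
      D (i + 1) ω ≤ 1 * D i ω + (-d * learningRate cγ β i + learningRate cγ β i * ξ i ω) := by
    intro ω i hi h
    have h1 := hP.drift ω i (hs.trans hi) (by linarith)
    obtain ⟨h2, h3⟩ := hγ i hi
    have h4 : δ / 2 ≤ min (D i ω) δ := le_min h.le (by linarith)
    have h5 : d ≤ θ * min (D i ω) δ - B * learningRate cγ β i := by
      have := mul_le_mul_of_nonneg_left h4 hθ.le
      have := mul_le_mul_of_nonneg_left h3 hB.le
      linarith
    have := mul_le_mul_of_nonneg_left h5 h2.le
    linarith
  have hrec : ∀ ω j, s ≤ j → j ≤ k → (∀ i, j ≤ i → i ≤ k → δ / 2 < D i ω) →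
      D k ω ≤ D j ω - d * ∑ i ∈ Finset.Ico j k, learningRate cγ β i
        + ∑ i ∈ Finset.Ico j k, learningRate cγ β i * ξ i ω := by
    intro ω j hj hjk h
    have := le_of_linear_recursion (D := fun i => D i ω) zero_le_one hjk
      (fun i h1 h2 => hdown ω i (hj.trans h1) (h i h1 h2.le))
    simp only [one_pow, one_mul, Finset.sum_add_distrib, ← Finset.mul_sum] at this
    linarith
  have hsub : {ω | δ < D k ω} ⊆
      {ω | d * S / 2 ≤ ∑ i ∈ Finset.Ico s k, learningRate cγ β i * ξ i ω} ∪
      ⋃ j ∈ Finset.Ico s k, {ω | δ / 4 + d * ∑ i ∈ Finset.Ico (j + 1) k, learningRate cγ β i ≤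
        ∑ i ∈ Finset.Ico (j + 1) k, learningRate cγ β i * ξ i ω} := by
    intro ω hω
    simp only [Set.mem_ofPred_eq] at hω
    rcases above_or_exists_last_le (fun i => D i ω) (δ / 2) hsk.le (by linarith) with
      h | ⟨j, hj, h1, h2⟩
    · left
      have h1 := hrec ω s le_rfl hsk.le h
      have h2 := hP.growth ω s hs
      have h3 := mul_le_mul_of_nonneg_left hS hdp.le
      simp only [Set.mem_ofPred_eq]
      linarith
    · right
      refine Set.mem_biUnion hj ?_
      simp only [Finset.mem_Ico] at hj
      have h3 := hrec ω (j + 1) (by omega) (by omega) h2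
      have h4 := hP.step ω j (hs.trans hj.1)
      have h5 := (hγ j hj.1).2
      simp only [Set.mem_ofPred_eq]
      linarith
  refine (measureReal_mono hsub).trans ((measureReal_union_le _ _).trans (add_le_add ?_ ?_))
  · refine hP.conc _ s k _ _ hs ?_ (by positivity) ?_
    · have : 0 < (k : ℝ) := by exact_mod_cast (by omega : 0 < k)
      positivity
    · calc _ ≤ ∑ i ∈ Finset.Ico s k, g ^ 2 := by
            refine Finset.sum_le_sum fun i hi => ?_
            simp only [Finset.mem_Ico] at hi
            exact pow_le_pow_left₀ (hγ i hi.1).1.le (hγ i hi.1).2 2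
        _ ≤ _ := by
          rw [Finset.sum_const, nsmul_eq_mul, Nat.card_Ico]
          gcongr
          omega
  · refine (measureReal_biUnion_Ico_le μ (c := Real.exp (-(δ * d / (8 * g)))) fun j h1 h2 => ?_).trans
      (by gcongr; omega)
    -- the variance proxy is at most `g * T`, and the required excess `δ / 4 + d * T` grows with `T`
    set T := ∑ i ∈ Finset.Ico (j + 1) k, learningRate cγ β i with hT
    have hT0 : 0 ≤ T := Finset.sum_nonneg fun i hi => by
      simp only [Finset.mem_Ico] at hi
      exact (hγ i (by omega)).1.le
    have ht : 0 < δ / 4 + d * T := by positivity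
    refine (hP.conc _ (j + 1) k (g * ((δ / 4 + d * T) / d)) _ (by omega) (by positivity) ht.le
      ?_).trans ?_
    · calc _ ≤ ∑ i ∈ Finset.Ico (j + 1) k, g * learningRate cγ β i := by
            refine Finset.sum_le_sum fun i hi => ?_
            simp only [Finset.mem_Ico] at hi
            have := hγ i (by omega)
            rw [pow_two]
            exact mul_le_mul_of_nonneg_right this.2 this.1.le
        _ = g * T := by rw [← Finset.mul_sum]
        _ ≤ _ := by
          gcongr
          rw [le_div_iff₀ hdp]
          linarith
    · rw [Real.exp_le_exp, neg_le_neg_iff]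
      have : (δ / 4 + d * T) ^ 2 / (2 * (g * ((δ / 4 + d * T) / d)))
          = (δ / 4 + d * T) * d / (2 * g) := by field_simp
      rw [this, div_le_div_iff₀ (by positivity) (by positivity)]
      nlinarith [mul_nonneg (mul_nonneg (mul_nonneg hdp.le hT0) hdp.le) hgp.le]

/-- The contraction estimate: a process that stays in `(0, δ]` contracts at least at the rate
`1 - θ γ_k`, so that exceeding `u` at time `k` needs a large noise after the last visit
below `0`. -/
lemma IsDriftProcess.tail_of_contraction {Ω : Type*} [MeasurableSpace Ω] {μ : Measure Ω}
    [IsProbabilityMeasure μ] {β cγ θ δ B R : ℝ} {D ξ : ℕ → Ω → ℝ}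
    (hP : IsDriftProcess μ β cγ θ δ B R D ξ)
    (hβ : 0 < β) (hcγ : 0 < cγ) (hθ : 0 < θ) (hδ : 0 < δ) (hB : 0 < B)
    {s k : ℕ} {g u V : ℝ} (hs : 1 ≤ s) (hsk : s < k) (hg : learningRate cγ β s ≤ g)
    (hu : 0 < u) (hr : θ * learningRate cγ β k < 1)
    (hV : V = g ^ 2 / (θ * learningRate cγ β k))
    (hsmall : g + (1 - θ * learningRate cγ β k) ^ (k - s) * δ + B * V ≤ u / 2) :
    μ.real {ω | u < D k ω ∧ ∀ i, s ≤ i → i ≤ k → D i ω ≤ δ} ≤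
      (1 + k) * Real.exp (-(u ^ 2 / (8 * V))) := by
  have hγ : ∀ i, s ≤ i → 0 < learningRate cγ β i ∧ learningRate cγ β i ≤ g := fun i hi =>
    ⟨learningRate_pos hcγ (hs.trans hi), (learningRate_anti hcγ hβ hs hi).trans hg⟩
  have hgp : 0 < g := (hγ s le_rfl).1.trans_le hg
  have hγk := (hγ k hsk.le).1
  have hVp : 0 < V := by rw [hV]; positivity
  set r := 1 - θ * learningRate cγ β k with hrdef
  have hr0 : 0 < r := by rw [hrdef]; linarith
  have hr1 : r < 1 := by rw [hrdef]; linarith [mul_pos hθ hγk]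
  have hr2 : (1 - r)⁻¹ = (θ * learningRate cγ β k)⁻¹ := by rw [hrdef]; congr 1; ring
  have hrec : ∀ ω j, s ≤ j → j ≤ k →
      (∀ i, j ≤ i → i ≤ k → 0 < D i ω) → (∀ i, s ≤ i → i ≤ k → D i ω ≤ δ) →
      D k ω ≤ r ^ (k - j) * D j ω + B * V
        + ∑ i ∈ Finset.Ico j k, r ^ (k - 1 - i) * learningRate cγ β i * ξ i ω := by
    intro ω j hj hjk h h'
    have h1 := le_of_linear_recursion (D := fun i => D i ω)
      (e := fun i => B * g ^ 2 + learningRate cγ β i * ξ i ω) hr0.le hjk (fun i h1 h2 => by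
        have h3 := hP.drift ω i (by omega) (h i h1 h2.le)
        rw [min_eq_left (h' i (by omega) h2.le)] at h3
        obtain ⟨h4, h5⟩ := hγ i (by omega)
        have h6 : learningRate cγ β k ≤ learningRate cγ β i :=
          learningRate_anti hcγ hβ (by omega) h2.le
        have h7 := mul_le_mul_of_nonneg_right h6 (mul_pos hθ (h i h1 h2.le)).le
        have h8 := mul_le_mul_of_nonneg_left (pow_le_pow_left₀ h4.le h5 2) hB.le
        simp only [hrdef]
        nlinarith)
    simp only [mul_add, Finset.sum_add_distrib, ← Finset.sum_mul] at h1
    have h2 := mul_le_mul_of_nonneg_right (sum_Ico_pow_le hr0.le hr1 j k)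
      (mul_pos hB (pow_pos hgp 2)).le
    rw [hr2] at h2
    have h3 : (θ * learningRate cγ β k)⁻¹ * (B * g ^ 2) = B * V := by rw [hV]; ring
    simp only [mul_assoc] at h1 ⊢
    linarith
  have hpow : ∀ n : ℕ, r ^ n ≤ 1 := fun n => pow_le_one₀ hr0.le hr1.le
  have hconc : ∀ j, 1 ≤ j → s ≤ j → μ.real {ω | u / 2 ≤
      ∑ i ∈ Finset.Ico j k, r ^ (k - 1 - i) * learningRate cγ β i * ξ i ω} ≤
      Real.exp (-(u ^ 2 / (8 * V))) := by
    intro j hj hsj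
    refine (hP.conc _ j k V (u / 2) hj hVp (by positivity) ?_).trans_eq ?_
    · calc _ ≤ ∑ i ∈ Finset.Ico j k, r ^ (k - 1 - i) * g ^ 2 := by
            refine Finset.sum_le_sum fun i hi => ?_
            simp only [Finset.mem_Ico] at hi
            obtain ⟨h4, h5⟩ := hγ i (by omega)
            rw [mul_pow]
            have h6 : (r ^ (k - 1 - i)) ^ 2 ≤ r ^ (k - 1 - i) :=
              pow_le_of_le_one (by positivity) (hpow _) two_ne_zero
            gcongr
        _ ≤ (1 - r)⁻¹ * g ^ 2 := by
          rw [← Finset.sum_mul]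
          exact mul_le_mul_of_nonneg_right (sum_Ico_pow_le hr0.le hr1 j k) (by positivity)
        _ = V := by rw [hr2, hV]; ring
    · congr 2; field_simp; ring
  have hsub : {ω | u < D k ω ∧ ∀ i, s ≤ i → i ≤ k → D i ω ≤ δ} ⊆
      {ω | u / 2 ≤ ∑ i ∈ Finset.Ico s k, r ^ (k - 1 - i) * learningRate cγ β i * ξ i ω} ∪
      ⋃ j ∈ Finset.Ico s k, {ω | u / 2 ≤
        ∑ i ∈ Finset.Ico (j + 1) k, r ^ (k - 1 - i) * learningRate cγ β i * ξ i ω} := by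
    rintro ω ⟨hω, hgood⟩
    rcases above_or_exists_last_le (fun i => D i ω) 0 hsk.le (hu.trans hω) with
      h | ⟨j, hj, h1, h2⟩
    · left
      have h1 := hrec ω s le_rfl hsk.le h hgood
      have h2 := mul_le_mul_of_nonneg_left (hgood s le_rfl hsk.le) (pow_pos hr0 (k - s)).le
      simp only [Set.mem_ofPred_eq]
      linarith
    · right
      refine Set.mem_biUnion hj ?_
      simp only [Finset.mem_Ico] at hj
      have h3 := hrec ω (j + 1) (by omega) (by omega) h2 hgood
      have h4 := hP.step ω j (hs.trans hj.1)
      have h5 := (hγ j hj.1).2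
      have h6 : r ^ (k - (j + 1)) * D (j + 1) ω ≤ g := by
        have h7 := mul_le_mul_of_nonneg_right (hpow (k - (j + 1))) (h2 (j + 1) le_rfl (by omega)).le
        linarith
      have h7 : 0 ≤ r ^ (k - s) * δ := by positivity
      simp only [Set.mem_ofPred_eq]
      linarith
  refine (measureReal_mono hsub).trans ((measureReal_union_le _ _).trans ?_)
  rw [add_mul, one_mul]
  refine add_le_add (hconc s hs le_rfl) ?_
  refine (measureReal_biUnion_Ico_le μ (c := Real.exp (-(u ^ 2 / (8 * V)))) fun j h1 h2 =>
    hconc (j + 1) (by omega) (by omega)).trans ?_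
  gcongr
  omega

/-! ### Drift processes: tail bounds -/

lemma exists_forall_natCast_rpow_neg_le {β c : ℝ} (hβ : 0 < β) (hc : 0 < c) (m : ℝ) :
    ∃ K : ℕ, 1 ≤ K ∧ ∀ k : ℕ, K ≤ k → (k : ℝ) ^ (-β) ≤ c ∧ m ≤ k := by
  have h1 : Filter.Tendsto (fun k : ℕ => (k : ℝ) ^ (-β)) Filter.atTop (nhds 0) :=
    (tendsto_rpow_neg_atTop hβ).comp tendsto_natCast_atTop_atTop
  have h2 := (h1.eventually_le_const hc).and (tendsto_natCast_atTop_atTop.eventually_ge_atTop m)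
  obtain ⟨K, hK⟩ := Filter.eventually_atTop.1 h2
  exact ⟨max K 1, le_max_right _ _, fun k hk => hK k ((le_max_left _ _).trans hk)⟩

/-- Large-deviation bound for a drift process at a fixed level. Starting from time `ε k`, where
the deterministic growth bound is small compared with the accumulated drift, removes any influence
of the initial phase. -/
lemma exists_tail_const_level {β cγ θ δ B R : ℝ} (hβ : 1 / 2 < β) (hβ' : β < 1) (hcγ : 0 < cγ)
    (hθ : 0 < θ) (hδ : 0 < δ) (hB : 0 < B) (hR : 0 < R) :
    ∃ C b : ℝ, 0 < C ∧ 0 < b ∧ ∀ (Ω : Type*) (_ : MeasurableSpace Ω) (μ : Measure Ω)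
      (_ : IsProbabilityMeasure μ) (D ξ : ℕ → Ω → ℝ), IsDriftProcess μ β cγ θ δ B R D ξ →
      ∀ k : ℕ, 1 ≤ k → μ.real {ω | δ < D k ω} ≤ C * Real.exp (-(b * (k : ℝ) ^ β)) := by
  have hβ0 : 0 < β := by linarith
  have h1β : 0 < 1 - β := by linarith
  set d := θ * δ / 4 with hd
  have hdp : 0 < d := by positivity
  set ε := min (1 / 2) ((d * cγ / (4 * R)) ^ (1 - β)⁻¹) with hε
  have hεp : 0 < ε := by positivity
  have hε2 : ε ≤ 1 / 2 := min_le_left _ _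
  have hε3 : R * ε ^ (1 - β) ≤ d * cγ / 4 := by
    have : ε ^ (1 - β) ≤ d * cγ / (4 * R) := by
      calc _ ≤ ((d * cγ / (4 * R)) ^ (1 - β)⁻¹) ^ (1 - β) :=
            Real.rpow_le_rpow hεp.le (min_le_right _ _) h1β.le
        _ = _ := Real.rpow_inv_rpow (by positivity) h1β.ne'
    calc _ ≤ R * (d * cγ / (4 * R)) := by gcongr
      _ = _ := by field_simp
  set A := cγ * (ε / 2) ^ (-β) with hA
  have hAp : 0 < A := by positivity
  obtain ⟨K, hK1, hK⟩ := exists_forall_natCast_rpow_neg_le (c := min (δ / (4 * A)) (d / (B * A)))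
    hβ0 (by positivity) (1 / ε)
  set b₀ := min ((d * cγ / 4) ^ 2 / (2 * A ^ 2)) (δ * d / (8 * A)) with hb₀
  have hb₀p : 0 < b₀ := by positivity
  obtain ⟨C₁, hC₁, hexp⟩ := exists_natCast_rpow_le_mul_exp (half_pos hb₀p) hβ0 1
  refine ⟨2 * C₁ + Real.exp (b₀ / 2 * (K : ℝ) ^ β), b₀ / 2, by positivity, by positivity, ?_⟩
  intro Ω _ μ _ D ξ hP k hk
  have hkp : (0 : ℝ) < k := by exact_mod_cast hk
  have hk1 : (1 : ℝ) ≤ k := by exact_mod_cast hk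
  rcases Nat.lt_or_ge k K with hkK | hkK
  · refine measureReal_le_one.trans ?_
    have h1 : (k : ℝ) ^ β ≤ (K : ℝ) ^ β :=
      Real.rpow_le_rpow hkp.le (by exact_mod_cast hkK.le) hβ0.le
    calc (1 : ℝ) ≤ Real.exp (b₀ / 2 * (K : ℝ) ^ β) * Real.exp (-(b₀ / 2 * (k : ℝ) ^ β)) := by
          rw [← Real.exp_add]
          have := mul_le_mul_of_nonneg_left h1 (half_pos hb₀p).le
          exact Real.one_le_exp (by linarith)
      _ ≤ _ := by gcongr; linarith
  obtain ⟨hsm, hkε⟩ := hK k hkK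
  have hεk : 1 ≤ ε * k := by
    rw [div_le_iff₀ hεp] at hkε; linarith
  have hs1 : 1 ≤ ⌊ε * k⌋₊ := Nat.one_le_floor_iff _ |>.2 hεk
  have hs2 : (⌊ε * k⌋₊ : ℝ) ≤ ε * k := Nat.floor_le (by positivity)
  have hs3 : ε / 2 * k ≤ (⌊ε * k⌋₊ : ℝ) := by
    have h1 := Nat.lt_floor_add_one (ε * k)
    have h2 : (1 : ℝ) ≤ ⌊ε * k⌋₊ := by exact_mod_cast hs1
    linarith
  have hs4 : (⌊ε * k⌋₊ : ℝ) ≤ k / 2 := hs2.trans (by nlinarith)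
  have hsk : ⌊ε * k⌋₊ < k := by
    have : (⌊ε * k⌋₊ : ℝ) < k := by linarith
    exact_mod_cast this
  have hkβ : (k : ℝ) ^ (1 - β) = k * (k : ℝ) ^ (-β) := by
    rw [sub_eq_add_neg, Real.rpow_add hkp, Real.rpow_one]
  have hg : learningRate cγ β ⌊ε * k⌋₊ ≤ A * (k : ℝ) ^ (-β) := by
    refine (learningRate_le hcγ hβ0 (by positivity) hs3).trans_eq ?_
    rw [Real.mul_rpow (by positivity) hkp.le, hA]; ring
  have hmain := hP.tail_of_steps (g := A * (k : ℝ) ^ (-β)) (d := d)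
    (S := cγ / 2 * (k : ℝ) ^ (1 - β)) hβ0 hcγ hθ hδ hB hs1 hsk
    hg (by positivity) hd ?_ ?_ ?_ (by positivity) ?_
  · refine hmain.trans ?_
    have e1 : (d * (cγ / 2 * (k : ℝ) ^ (1 - β)) / 2) ^ 2 / (2 * (k * (A * (k : ℝ) ^ (-β)) ^ 2))
        = (d * cγ / 4) ^ 2 / (2 * A ^ 2) * k := by
      rw [hkβ]
      have : (k : ℝ) ^ (-β) ≠ 0 := by positivity
      field_simp; ring
    have e2 : δ * d / (8 * (A * (k : ℝ) ^ (-β))) = δ * d / (8 * A) * (k : ℝ) ^ β := by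
      rw [Real.rpow_neg hkp.le]
      have : (k : ℝ) ^ β ≠ 0 := by positivity
      field_simp
    have hkβ1 : (k : ℝ) ^ β ≤ k := by
      simpa using Real.rpow_le_rpow_of_exponent_le hk1 hβ'.le
    have i1 : Real.exp (-((d * cγ / 4) ^ 2 / (2 * A ^ 2) * k)) ≤ Real.exp (-(b₀ * (k : ℝ) ^ β)) := by
      rw [Real.exp_le_exp, neg_le_neg_iff]
      gcongr
      exact min_le_left _ _
    have i2 : Real.exp (-(δ * d / (8 * A) * (k : ℝ) ^ β)) ≤ Real.exp (-(b₀ * (k : ℝ) ^ β)) := by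
      rw [Real.exp_le_exp, neg_le_neg_iff]
      gcongr
      exact min_le_right _ _
    have h3 := hexp k hk
    rw [Real.rpow_one] at h3
    rw [e1, e2]
    calc _ ≤ Real.exp (-(b₀ * (k : ℝ) ^ β)) + k * Real.exp (-(b₀ * (k : ℝ) ^ β)) := by gcongr
      _ ≤ (2 * k) * Real.exp (-(b₀ * (k : ℝ) ^ β)) := by
        linarith [le_mul_of_one_le_left (Real.exp_pos (-(b₀ * (k : ℝ) ^ β))).le hk1]
      _ ≤ (2 * (C₁ * Real.exp (b₀ / 2 * (k : ℝ) ^ β))) * Real.exp (-(b₀ * (k : ℝ) ^ β)) := by gcongr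
      _ = 2 * C₁ * Real.exp (-(b₀ / 2 * (k : ℝ) ^ β)) := by
        rw [mul_assoc, mul_assoc, ← Real.exp_add, mul_assoc]
        congr 3; ring_nf
      _ ≤ _ := by
        gcongr
        linarith [Real.exp_pos (b₀ / 2 * (K : ℝ) ^ β)]
  · have := hsm.trans (min_le_left _ _)
    rw [le_div_iff₀ (by positivity)] at this
    linarith
  · have := hsm.trans (min_le_right _ _)
    rw [le_div_iff₀ (by positivity)] at this
    linarith
  · calc cγ / 2 * (k : ℝ) ^ (1 - β) = (k / 2 : ℝ) * learningRate cγ β k := by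
          rw [hkβ, learningRate]; ring
      _ ≤ ((k - ⌊ε * k⌋₊ : ℕ) : ℝ) * learningRate cγ β k := by
        have := (learningRate_pos (β := β) hcγ hk).le
        gcongr
        rw [Nat.cast_sub hsk.le]
        linarith
      _ ≤ _ := by
        rw [← nsmul_eq_mul, ← Nat.card_Ico]
        refine Finset.card_nsmul_le_sum _ _ _ fun i hi => ?_
        simp only [Finset.mem_Ico] at hi
        exact learningRate_anti hcγ hβ0 (by omega) hi.2.le
  · calc R * (⌊ε * k⌋₊ : ℝ) ^ (1 - β) ≤ R * (ε * k) ^ (1 - β) := by gcongr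
      _ = R * ε ^ (1 - β) * (k : ℝ) ^ (1 - β) := by
        rw [Real.mul_rpow hεp.le hkp.le]; ring
      _ ≤ d * cγ / 4 * (k : ℝ) ^ (1 - β) := by gcongr
      _ = _ := by ring

/-- Sub-Gaussian tails of a drift process at the scale `k ^ (-β / 2)`, up to the probability of
leaving the region where the drift is linear. -/
lemma exists_tail_bound {β cγ θ δ B R : ℝ} (hβ : 1 / 2 < β) (hβ' : β < 1) (hcγ : 0 < cγ)
    (hθ : 0 < θ) (hδ : 0 < δ) (hB : 0 < B) (hR : 0 < R) :
    ∃ C b : ℝ, 0 < C ∧ 0 < b ∧ ∀ (Ω : Type*) (_ : MeasurableSpace Ω) (μ : Measure Ω)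
      (_ : IsProbabilityMeasure μ) (D ξ : ℕ → Ω → ℝ), IsDriftProcess μ β cγ θ δ B R D ξ →
      ∀ k : ℕ, 1 ≤ k → ∀ u : ℝ, 0 < u → μ.real {ω | u < D k ω} ≤
        C * (k * Real.exp (-(b * ((k : ℝ) ^ β * u ^ 2))) + Real.exp (-(b * (k : ℝ) ^ β))) := by
  have hβ0 : 0 < β := by linarith
  have h1β : 0 < 1 - β := by linarith
  obtain ⟨C₁, b₁, hC₁, hb₁, htail⟩ := exists_tail_const_level hβ hβ' hcγ hθ hδ hB hR
  obtain ⟨A, hA⟩ : ∃ y, y = cγ * (1 / 2) ^ (-β) := ⟨_, rfl⟩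
  have hAp : 0 < A := by rw [hA]; positivity
  obtain ⟨A₂, hA₂⟩ : ∃ y, y = A ^ 2 / (θ * cγ) := ⟨_, rfl⟩
  have hA₂p : 0 < A₂ := by rw [hA₂]; positivity
  obtain ⟨C₂, hC₂, hexp₂⟩ := exists_natCast_rpow_le_mul_exp
    (show 0 < θ * cγ / 3 by positivity) h1β β
  obtain ⟨C₃, hC₃, hexp₃⟩ := exists_natCast_rpow_le_mul_exp
    (show 0 < b₁ / 4 by positivity) hβ0 1
  obtain ⟨K, hK1, hK⟩ := exists_forall_natCast_rpow_neg_le (c := 1 / (2 * (θ * cγ)))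
    hβ0 (by positivity) 2
  obtain ⟨A₄, hA₄⟩ : ∃ y, y = A + C₂ * δ + B * A₂ := ⟨_, rfl⟩
  have hA₄p : 0 < A₄ := by rw [hA₄]; positivity
  obtain ⟨b, hb⟩ : ∃ y, y = min (b₁ / 4) (1 / (8 * A₂)) := ⟨_, rfl⟩
  have hbp : 0 < b := by rw [hb]; positivity
  refine ⟨Real.exp (b * (K : ℝ) ^ β) + Real.exp (b * (2 * A₄) ^ 2) + 2 * C₁ * C₃ + 2, b,
    by positivity, hbp, ?_⟩
  intro Ω _ μ _ D ξ hP k hk u hu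
  have hkp : (0 : ℝ) < k := by exact_mod_cast hk
  have hk1 : (1 : ℝ) ≤ k := by exact_mod_cast hk
  obtain ⟨P₁, hP₁⟩ : ∃ y, y = Real.exp (-(b * ((k : ℝ) ^ β * u ^ 2))) := ⟨_, rfl⟩
  obtain ⟨P₂, hP₂⟩ : ∃ y, y = Real.exp (-(b * (k : ℝ) ^ β)) := ⟨_, rfl⟩
  rw [← hP₁, ← hP₂]
  have hP₁p : 0 < P₁ := hP₁ ▸ Real.exp_pos _
  have hP₂p : 0 < P₂ := hP₂ ▸ Real.exp_pos _
  have hE₁ := Real.exp_pos (b * (K : ℝ) ^ β)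
  have hE₂ := Real.exp_pos (b * (2 * A₄) ^ 2)
  have hCC : 0 < 2 * C₁ * C₃ := by positivity
  have hkP₁ : 0 < k * P₁ := mul_pos hkp hP₁p
  rcases Nat.lt_or_ge k K with hkK | hkK
  · refine measureReal_le_one.trans ?_
    have h1 : (k : ℝ) ^ β ≤ (K : ℝ) ^ β :=
      Real.rpow_le_rpow hkp.le (by exact_mod_cast hkK.le) hβ0.le
    have h2 : (1 : ℝ) ≤ Real.exp (b * (K : ℝ) ^ β) * P₂ := by
      rw [hP₂, ← Real.exp_add]
      have := mul_le_mul_of_nonneg_left h1 hbp.le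
      exact Real.one_le_exp (by linarith)
    calc (1 : ℝ) ≤ Real.exp (b * (K : ℝ) ^ β) * P₂ := h2
      _ ≤ _ := mul_le_mul (by linarith) (by linarith) hP₂p.le (by positivity)
  -- below the scale `u ~ k ^ (-β / 2)` the bound exceeds one by the choice of the constant
  rcases le_or_gt ((k : ℝ) ^ β * u ^ 2) ((2 * A₄) ^ 2) with hku | hku
  · refine measureReal_le_one.trans ?_
    have h2 : (1 : ℝ) ≤ Real.exp (b * (2 * A₄) ^ 2) * P₁ := by
      rw [hP₁, ← Real.exp_add]
      have := mul_le_mul_of_nonneg_left hku hbp.le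
      exact Real.one_le_exp (by linarith)
    calc (1 : ℝ) ≤ Real.exp (b * (2 * A₄) ^ 2) * P₁ := h2
      _ ≤ _ := mul_le_mul (by linarith)
        (by linarith [le_mul_of_one_le_left hP₁p.le hk1]) hP₁p.le (by positivity)
  obtain ⟨hsm, hk2⟩ := hK k hkK
  have hk2' : 2 ≤ k := by exact_mod_cast hk2
  have hkβ : (k : ℝ) ^ (1 - β) = k * (k : ℝ) ^ (-β) := by
    rw [sub_eq_add_neg, Real.rpow_add hkp, Real.rpow_one]
  have hsk : (k + 1) / 2 < k := by omega
  have hs1 : 1 ≤ (k + 1) / 2 := by omega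
  have hs2 : (1 / 2 * k : ℝ) ≤ ((k + 1) / 2 : ℕ) := by
    have : k ≤ 2 * ((k + 1) / 2) := by omega
    have : (k : ℝ) ≤ 2 * ((k + 1) / 2 : ℕ) := by exact_mod_cast this
    linarith
  have hs3 : (k / 3 : ℝ) ≤ (k - (k + 1) / 2 : ℕ) := by
    have : k ≤ 3 * (k - (k + 1) / 2) := by omega
    have : (k : ℝ) ≤ 3 * (k - (k + 1) / 2 : ℕ) := by exact_mod_cast this
    linarith
  have hg : learningRate cγ β ((k + 1) / 2) ≤ A * (k : ℝ) ^ (-β) := by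
    refine (learningRate_le hcγ hβ0 (by positivity) hs2).trans_eq ?_
    rw [Real.mul_rpow (by positivity) hkp.le, hA]; ring
  have hγk : θ * learningRate cγ β k ≤ 1 / 2 := by
    rw [le_div_iff₀ (by positivity)] at hsm
    rw [learningRate]
    linarith
  have hγkp : 0 < θ * learningRate cγ β k := mul_pos hθ (learningRate_pos hcγ hk)
  -- the contraction over `[k / 2, k]` is `exp (-c k ^ (1 - β))`, hence negligible
  have hpow : (1 - θ * learningRate cγ β k) ^ (k - (k + 1) / 2) ≤ C₂ * (k : ℝ) ^ (-β) := by
    have h1 : 1 - θ * learningRate cγ β k ≤ Real.exp (-(θ * learningRate cγ β k)) := by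
      linarith [Real.add_one_le_exp (-(θ * learningRate cγ β k))]
    calc _ ≤ Real.exp (-(θ * learningRate cγ β k)) ^ (k - (k + 1) / 2) :=
          pow_le_pow_left₀ (by linarith) h1 _
      _ = Real.exp (-((k - (k + 1) / 2 : ℕ) * (θ * learningRate cγ β k))) := by
        rw [← Real.exp_nat_mul]; congr 1; ring
      _ ≤ Real.exp (-(θ * cγ / 3 * (k : ℝ) ^ (1 - β))) := by
        rw [Real.exp_le_exp, neg_le_neg_iff]
        calc _ = (k / 3 : ℝ) * (θ * learningRate cγ β k) := by
              rw [hkβ, learningRate]; ring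
          _ ≤ _ := by gcongr
      _ ≤ _ := by
        have h2 := hexp₂ k hk
        rw [Real.exp_neg, Real.rpow_neg hkp.le, ← div_eq_mul_inv, le_div_iff₀ (by positivity),
          inv_mul_le_iff₀ (Real.exp_pos _)]
        linarith
  obtain ⟨V, hV⟩ : ∃ y, y = (A * (k : ℝ) ^ (-β)) ^ 2 / (θ * learningRate cγ β k) := ⟨_, rfl⟩
  have hV' : V = A₂ * (k : ℝ) ^ (-β) := by
    have : (k : ℝ) ^ (-β) ≠ 0 := by positivity
    rw [hV, hA₂, learningRate]; field_simp
  -- step size, bias and contracted initial value are all `O(k ^ (-β))`, which is less than `u`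
  have hu2 : A₄ * (k : ℝ) ^ (-β) ≤ u / 2 := by
    have h1 : (2 * A₄ * (k : ℝ) ^ (-β)) ^ 2 ≤ u ^ 2 := by
      have h2 : (k : ℝ) ^ β * (k : ℝ) ^ (-β) = 1 := by
        rw [← Real.rpow_add hkp]; simp
      have h3 : (k : ℝ) ^ (-β) ≤ 1 := Real.rpow_le_one_of_one_le_of_nonpos hk1 (by linarith)
      have h4 : (0 : ℝ) < (k : ℝ) ^ (-β) := by positivity
      calc _ = ((2 * A₄) ^ 2 * (k : ℝ) ^ (-β)) * (k : ℝ) ^ (-β) := by ring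
        _ ≤ ((k : ℝ) ^ β * u ^ 2 * (k : ℝ) ^ (-β)) * 1 := by gcongr
        _ = ((k : ℝ) ^ β * (k : ℝ) ^ (-β)) * u ^ 2 := by ring
        _ = u ^ 2 := by rw [h2, one_mul]
    linarith [(pow_le_pow_iff_left₀ (by positivity) hu.le two_ne_zero).1 h1]
  have hmain := hP.tail_of_contraction (V := V) hβ0 hcγ hθ hδ hB hs1 hsk hg hu (by linarith) hV (by
    refine le_trans ?_ hu2
    rw [hV', hA₄]
    have := mul_le_mul_of_nonneg_right hpow hδ.le
    linarith)
  have hsub : {ω | u < D k ω} ⊆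
      {ω | u < D k ω ∧ ∀ i, (k + 1) / 2 ≤ i → i ≤ k → D i ω ≤ δ} ∪
      ⋃ i ∈ Finset.Ico ((k + 1) / 2) (k + 1), {ω | δ < D i ω} := by
    intro ω hω
    by_cases h : ∀ i, (k + 1) / 2 ≤ i → i ≤ k → D i ω ≤ δ
    · exact Or.inl ⟨hω, h⟩
    · push Not at h
      obtain ⟨i, h1, h2, h3⟩ := h
      exact Or.inr (Set.mem_biUnion (Finset.mem_Ico.2 ⟨h1, by omega⟩) h3)
  have hbad : μ.real (⋃ i ∈ Finset.Ico ((k + 1) / 2) (k + 1), {ω | δ < D i ω}) ≤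
      2 * C₁ * C₃ * P₂ := by
    refine (measureReal_biUnion_Ico_le μ (c := C₁ * Real.exp (-(b₁ / 2 * (k : ℝ) ^ β)))
      fun i h1 h2 => ?_).trans ?_
    · refine (htail Ω _ μ inferInstance D ξ hP i (by omega)).trans ?_
      have h3 : 1 / 2 * (k : ℝ) ^ β ≤ (i : ℝ) ^ β := by
        have h4 : (1 / 2 * k : ℝ) ≤ i := hs2.trans (by exact_mod_cast h1)
        calc 1 / 2 * (k : ℝ) ^ β ≤ (1 / 2) ^ β * (k : ℝ) ^ β := by
              gcongr
              simpa using Real.rpow_le_rpow_of_exponent_ge (by norm_num : (0 : ℝ) < 1 / 2)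
                (by norm_num) hβ'.le
          _ = (1 / 2 * k) ^ β := (Real.mul_rpow (by norm_num) hkp.le).symm
          _ ≤ _ := by gcongr
      refine mul_le_mul_of_nonneg_left (Real.exp_le_exp.2 ?_) hC₁.le
      have := mul_le_mul_of_nonneg_left h3 hb₁.le
      linarith
    · have h3 := hexp₃ k hk
      rw [Real.rpow_one] at h3
      have h4 : ((k + 1 - (k + 1) / 2 : ℕ) : ℝ) ≤ 2 * k := by
        have : k + 1 - (k + 1) / 2 ≤ 2 * k := by omega
        exact_mod_cast this
      calc _ ≤ (2 * (C₃ * Real.exp (b₁ / 4 * (k : ℝ) ^ β))) *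
            (C₁ * Real.exp (-(b₁ / 2 * (k : ℝ) ^ β))) := by
              gcongr
              linarith
        _ = 2 * C₁ * C₃ * (Real.exp (b₁ / 4 * (k : ℝ) ^ β)
            * Real.exp (-(b₁ / 2 * (k : ℝ) ^ β))) := by ring
        _ = 2 * C₁ * C₃ * Real.exp (-(b₁ / 4 * (k : ℝ) ^ β)) := by
          rw [← Real.exp_add]; congr 2; ring
        _ ≤ _ := by
          rw [hP₂, hb]
          gcongr
          exact min_le_left _ _
  have hgood : (1 + k) * Real.exp (-(u ^ 2 / (8 * V))) ≤ 2 * (k * P₁) := by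
    have h1 : Real.exp (-(u ^ 2 / (8 * V))) ≤ P₁ := by
      rw [hP₁, Real.exp_le_exp, neg_le_neg_iff, hV']
      calc b * ((k : ℝ) ^ β * u ^ 2) ≤ 1 / (8 * A₂) * ((k : ℝ) ^ β * u ^ 2) := by
            rw [hb]
            gcongr
            exact min_le_right _ _
        _ = _ := by
          rw [Real.rpow_neg hkp.le]
          have : (k : ℝ) ^ β ≠ 0 := by positivity
          field_simp
    calc _ ≤ (k + k) * P₁ := by gcongr
      _ = _ := by ring
  refine (measureReal_mono hsub).trans ((measureReal_union_le _ _).trans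
    ((add_le_add (hmain.trans hgood) hbad).trans ?_))
  rw [mul_add]
  gcongr <;> linarith

/-! ### The smoothed distribution function and quantiles -/

lemma smoothStep_nonneg (x : ℝ) : 0 ≤ smoothStep x := by
  unfold smoothStep; split_ifs <;> linarith

lemma smoothStep_le_one (x : ℝ) : smoothStep x ≤ 1 := by
  unfold smoothStep; split_ifs <;> linarith

lemma smoothStep_mono {x y : ℝ} (h : x ≤ y) : smoothStep x ≤ smoothStep y := by
  unfold smoothStep; split_ifs <;> linarith

lemma smoothStep_sub_le {x y : ℝ} (h : x ≤ y) : smoothStep y - smoothStep x ≤ (y - x) / 2 := by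
  unfold smoothStep; split_ifs <;> linarith

lemma measurable_smoothStepScaled (h : ℝ) : Measurable (smoothStepScaled h) :=
  (Monotone.measurable (fun _ _ => smoothStep_mono)).comp (measurable_id.div_const h)

lemma smoothStepScaled_eq_one {h x : ℝ} (hh : 0 < h) (hx : h ≤ x) : smoothStepScaled h x = 1 := by
  rw [smoothStepScaled, smoothStep, if_pos ((one_le_div hh).2 hx)]

lemma smoothStepScaled_eq_zero {h x : ℝ} (hh : 0 < h) (hx : x < -h) :
    smoothStepScaled h x = 0 := by
  have h1 : x / h < -1 := by rw [div_lt_iff₀ hh]; linarith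
  rw [smoothStepScaled, smoothStep, if_neg (by linarith), if_neg (by linarith)]

/-- The distribution function of `X` smoothed at scale `h`, i.e. `y ↦ E g_h(y - X)` for `X` with
law `ν`. -/
noncomputable def smoothedCDF (ν : Measure ℝ) (h y : ℝ) : ℝ :=
  ∫ x, smoothStepScaled h (y - x) ∂ν

lemma integrable_smoothStepScaled (ν : Measure ℝ) [IsProbabilityMeasure ν] (h y : ℝ) :
    Integrable (fun x => smoothStepScaled h (y - x)) ν := by
  refine Integrable.of_bound (C := 1)
    ((measurable_smoothStepScaled h).comp (measurable_const.sub measurable_id)).aestronglyMeasurable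
    (ae_of_all _ fun x => ?_)
  rw [Real.norm_eq_abs, abs_of_nonneg (show 0 ≤ smoothStepScaled h (y - x) from smoothStep_nonneg _)]
  exact smoothStep_le_one _

lemma measurable_smoothedCDF (ν : Measure ℝ) [IsProbabilityMeasure ν] (h : ℝ) :
    Measurable (smoothedCDF ν h) := by
  have : Measurable (Function.uncurry fun y x : ℝ => smoothStepScaled h (y - x)) :=
    (measurable_smoothStepScaled h).comp (measurable_fst.sub measurable_snd)
  exact this.stronglyMeasurable.integral_prod_right.measurable

lemma smoothedCDF_le (ν : Measure ℝ) [IsProbabilityMeasure ν] {h : ℝ} (hh : 0 < h) (y : ℝ) :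
    smoothedCDF ν h y ≤ ν.real (Set.Iic (y + h)) := by
  rw [← integral_indicator_one measurableSet_Iic]
  refine integral_mono (integrable_smoothStepScaled ν h y)
    ((integrable_const 1).indicator measurableSet_Iic) fun x => ?_
  by_cases hx : x ≤ y + h
  · simp only [Set.indicator, Set.mem_Iic, hx, if_true]
    exact smoothStep_le_one _
  · simp only [Set.indicator, Set.mem_Iic, hx, if_false]
    rw [smoothStepScaled_eq_zero hh (by linarith)]

lemma le_smoothedCDF (ν : Measure ℝ) [IsProbabilityMeasure ν] {h : ℝ} (hh : 0 < h) (y : ℝ) :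
    ν.real (Set.Iic (y - h)) ≤ smoothedCDF ν h y := by
  rw [← integral_indicator_one measurableSet_Iic]
  refine integral_mono ((integrable_const 1).indicator measurableSet_Iic)
    (integrable_smoothStepScaled ν h y) fun x => ?_
  by_cases hx : x ≤ y - h
  · simp only [Set.indicator, Set.mem_Iic, hx, if_true]
    rw [smoothStepScaled_eq_one hh (by linarith)]
    rfl
  · simp only [Set.indicator, Set.mem_Iic, hx, if_false]
    exact smoothStep_nonneg _

/-- The probability law `ν` on the line has a differentiable density `f`, and both `f` and its
derivative are bounded by `c`. -/
structure HasSmoothDensity (ν : Measure ℝ) (f : ℝ → ℝ) (c : ℝ) : Prop where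
  nonneg : ∀ x, 0 ≤ f x
  eq : ν = volume.withDensity (fun x => ENNReal.ofReal (f x))
  diff : Differentiable ℝ f
  le : ∀ x, |f x| ≤ c
  deriv_le : ∀ x, |deriv f x| ≤ c

namespace HasSmoothDensity

variable {ν : Measure ℝ} [IsProbabilityMeasure ν] {f : ℝ → ℝ} {c : ℝ}

lemma cdf_sub_cdf (H : HasSmoothDensity ν f c) (a b : ℝ) :
    ν.real (Set.Iic b) - ν.real (Set.Iic a) = ∫ x in a..b, f x := by
  have key : ∀ a b : ℝ, a ≤ b →
      ν.real (Set.Iic b) - ν.real (Set.Iic a) = ∫ x in a..b, f x := by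
    intro a b hab
    rw [← measureReal_sdiff (Set.Iic_subset_Iic.2 hab) measurableSet_Iic]
    have h1 : Set.Iic b \ Set.Iic a = Set.Ioc a b := by
      ext x; simp [and_comm]
    rw [h1, intervalIntegral.integral_of_le hab, integral_eq_lintegral_of_nonneg_ae
      (ae_of_all _ H.nonneg) H.diff.continuous.aestronglyMeasurable, Measure.real,
      H.eq, withDensity_apply _ measurableSet_Ioc]
  rcases le_total a b with h | h
  · exact key a b h
  · rw [intervalIntegral.integral_symm, ← key b a h]; ring

lemma cdf_mono (a b : ℝ) (hab : a ≤ b) : ν.real (Set.Iic a) ≤ ν.real (Set.Iic b) :=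
  measureReal_mono (Set.Iic_subset_Iic.2 hab)

lemma cdf_sub_le (H : HasSmoothDensity ν f c) {a b : ℝ} (hab : a ≤ b) :
    ν.real (Set.Iic b) - ν.real (Set.Iic a) ≤ c * (b - a) := by
  rw [H.cdf_sub_cdf]
  have := intervalIntegral.norm_integral_le_of_norm_le_const (a := a) (b := b) (f := f) (C := c)
    fun x _ => H.le x
  rw [abs_of_nonneg (by linarith : 0 ≤ b - a)] at this
  exact (le_abs_self _).trans this

lemma abs_smoothedCDF_sub_le (H : HasSmoothDensity ν f c) {h : ℝ} (hh : 0 < h) (y : ℝ) :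
    |smoothedCDF ν h y - ν.real (Set.Iic y)| ≤ c * h := by
  have h1 := smoothedCDF_le ν hh y
  have h2 := le_smoothedCDF ν hh y
  have h3 := H.cdf_sub_le (a := y) (b := y + h) (by linarith)
  have h4 := H.cdf_sub_le (a := y - h) (b := y) (by linarith)
  rw [abs_le]
  constructor <;> nlinarith

lemma abs_cdf_linearization_le (H : HasSmoothDensity ν f c) (q y : ℝ) :
    |ν.real (Set.Iic y) - ν.real (Set.Iic q) - f q * (y - q)| ≤ c * (y - q) ^ 2 := by
  have hc : 0 ≤ c := (abs_nonneg _).trans (H.le 0)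
  have h1 : ν.real (Set.Iic y) - ν.real (Set.Iic q) - f q * (y - q)
      = ∫ x in q..y, (f x - f q) := by
    rw [H.cdf_sub_cdf, intervalIntegral.integral_sub
      (H.diff.continuous.intervalIntegrable _ _) (by simp)]
    simp only [intervalIntegral.integral_const, smul_eq_mul]
    ring
  rw [h1]
  have h2 : ∀ x ∈ Set.uIoc q y, ‖f x - f q‖ ≤ c * |y - q| := by
    intro x hx
    have h3 := Convex.norm_image_sub_le_of_norm_deriv_le (f := f) (C := c) (s := Set.univ)
      (fun x _ => H.diff x) (fun x _ => H.deriv_le x) convex_univ (Set.mem_univ q) (Set.mem_univ x)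
    refine h3.trans (mul_le_mul_of_nonneg_left ?_ hc)
    rw [Real.norm_eq_abs]
    exact Set.abs_sub_left_of_mem_uIcc (Set.uIoc_subset_uIcc hx)
  have h4 := intervalIntegral.norm_integral_le_of_norm_le_const h2
  rw [Real.norm_eq_abs, mul_assoc, abs_mul_abs_self, ← pow_two] at h4
  exact h4

/-- To the right of a point where the density is at least `cL`, the distribution function grows
at least linearly until the distance `cL / (2 c)`. -/
lemma le_cdf_sub (H : HasSmoothDensity ν f c) {q y cL : ℝ} (hc : 0 < c) (hcL : 0 < cL)
    (hq : cL ≤ f q) (hy : q ≤ y) :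
    cL / 2 * min (y - q) (cL / (2 * c)) ≤ ν.real (Set.Iic y) - ν.real (Set.Iic q) := by
  set m := min (y - q) (cL / (2 * c)) with hm
  have hm0 : 0 ≤ m := le_min (by linarith) (by positivity)
  have hm1 : c * m ≤ cL / 2 := by
    calc c * m ≤ c * (cL / (2 * c)) := by gcongr; exact min_le_right _ _
      _ = _ := by field_simp
  have h1 := (abs_le.1 (H.abs_cdf_linearization_le q (q + m))).1
  have h2 := cdf_mono (ν := ν) (q + m) y (by linarith [min_le_left (y - q) (cL / (2 * c))])
  rw [add_sub_cancel_left] at h1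
  nlinarith [mul_le_mul_of_nonneg_right hq hm0, mul_le_mul_of_nonneg_right hm1 hm0]

lemma le_cdf_sub' (H : HasSmoothDensity ν f c) {q y cL : ℝ} (hc : 0 < c) (hcL : 0 < cL)
    (hq : cL ≤ f q) (hy : y ≤ q) :
    cL / 2 * min (q - y) (cL / (2 * c)) ≤ ν.real (Set.Iic q) - ν.real (Set.Iic y) := by
  set m := min (q - y) (cL / (2 * c)) with hm
  have hm0 : 0 ≤ m := le_min (by linarith) (by positivity)
  have hm1 : c * m ≤ cL / 2 := by
    calc c * m ≤ c * (cL / (2 * c)) := by gcongr; exact min_le_right _ _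
      _ = _ := by field_simp
  have h1 := (abs_le.1 (H.abs_cdf_linearization_le q (q - m))).2
  have h2 := cdf_mono (ν := ν) y (q - m) (by linarith [min_le_left (q - y) (cL / (2 * c))])
  rw [sub_sub_cancel_left] at h1
  nlinarith [mul_le_mul_of_nonneg_right hq hm0, mul_le_mul_of_nonneg_right hm1 hm0]

end HasSmoothDensity

/-- The increments of the quantile loss are bounded below by a subgradient at `y`. -/
lemma le_quantileLoss_sub {τ : ℝ} (x q y : ℝ) :
    (q - y) * ((Set.Iic y).indicator 1 x - τ) ≤ quantileLoss τ (x - q) - quantileLoss τ (x - y) := by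
  unfold quantileLoss
  simp only [Set.indicator, Set.mem_Iic, Pi.one_apply]
  split_ifs <;> nlinarith

lemma abs_quantileLoss_sub_le {τ : ℝ} (h0 : 0 ≤ τ) (h1 : τ ≤ 1) (x q y : ℝ) :
    |quantileLoss τ (x - q) - quantileLoss τ (x - y)| ≤ |q - y| := by
  unfold quantileLoss
  rw [abs_le]
  rcases le_total q y with h | h
  · rw [abs_of_nonpos (by linarith)]
    constructor <;> split_ifs <;> nlinarith
  · rw [abs_of_nonneg (by linarith)]
    constructor <;> split_ifs <;> nlinarith

lemma measurable_quantileLoss (τ : ℝ) : Measurable (quantileLoss τ) := by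
  unfold quantileLoss
  exact measurable_id.mul (measurable_const.sub
    (Measurable.ite measurableSet_Iio measurable_const measurable_const))

lemma IsQuantile.cdf_eq {Ω : Type*} [MeasurableSpace Ω] {μ : Measure Ω} [IsProbabilityMeasure μ]
    {X : Ω → ℝ} (hX : Measurable X) {f : ℝ → ℝ} {c : ℝ} (H : HasSmoothDensity (μ.map X) f c)
    {τ q : ℝ} (h0 : 0 ≤ τ) (h1 : τ ≤ 1) (hq : IsQuantile μ X τ q) :
    (μ.map X).real (Set.Iic q) = τ := by
  have : IsProbabilityMeasure (μ.map X) := Measure.isProbabilityMeasure_map hX.aemeasurable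
  have key : ∀ y, (q - y) * ((μ.map X).real (Set.Iic y) - τ) ≤ 0 := by
    intro y
    refine le_trans ?_ (hq y)
    have hi : Integrable (fun x => (Set.Iic y).indicator (1 : ℝ → ℝ) x) (μ.map X) :=
      (integrable_const (1 : ℝ)).indicator measurableSet_Iic
    have hi' : Integrable (fun ω => (Set.Iic y).indicator (1 : ℝ → ℝ) (X ω)) μ :=
      hi.comp_measurable hX
    have e : (q - y) * ((μ.map X).real (Set.Iic y) - τ)
        = ∫ ω, (q - y) * ((Set.Iic y).indicator (1 : ℝ → ℝ) (X ω) - τ) ∂μ := by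
      rw [integral_const_mul, integral_sub hi' (integrable_const τ),
        ← integral_map (f := (Set.Iic y).indicator (1 : ℝ → ℝ)) hX.aemeasurable
          hi.aestronglyMeasurable, integral_indicator_one measurableSet_Iic]
      simp
    rw [e]
    refine integral_mono ((hi'.sub (integrable_const τ)).const_mul _) ?_
      fun ω => le_quantileLoss_sub (X ω) q y
    refine Integrable.of_bound (C := |q - y|) ?_ (ae_of_all _ fun ω =>
      abs_quantileLoss_sub_le h0 h1 _ _ _)
    exact (((measurable_quantileLoss τ).comp (hX.sub_const q)).sub
      ((measurable_quantileLoss τ).comp (hX.sub_const y))).aestronglyMeasurable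
  have hc : 0 ≤ c := (abs_nonneg _).trans (H.le 0)
  refine le_antisymm (le_of_forall_pos_le_add fun ε hε => ?_)
    (le_of_forall_pos_le_add fun ε hε => ?_)
  · have h2 := H.cdf_sub_le (a := q - ε / (c + 1)) (b := q) (by
      have : 0 < ε / (c + 1) := by positivity
      linarith)
    have h3 : 0 < ε / (c + 1) := by positivity
    have h4 := key (q - ε / (c + 1))
    rw [sub_sub_cancel] at h2 h4
    have h5 := nonpos_of_mul_nonpos_right h4 h3
    have h6 : c * (ε / (c + 1)) ≤ ε := by
      rw [← mul_div_assoc, div_le_iff₀ (by positivity)]; nlinarith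
    linarith
  · have h2 := H.cdf_sub_le (a := q) (b := q + ε / (c + 1)) (by
      have : 0 < ε / (c + 1) := by positivity
      linarith)
    have h3 : 0 < ε / (c + 1) := by positivity
    have h4 := key (q + ε / (c + 1))
    rw [add_sub_cancel_left] at h2
    have h5 : 0 ≤ (μ.map X).real (Set.Iic (q + ε / (c + 1))) - τ := by nlinarith
    have h6 : c * (ε / (c + 1)) ≤ ε := by
      rw [← mul_div_assoc, div_le_iff₀ (by positivity)]; nlinarith
    linarith

/-! ### Azuma's inequality for the noise of the smoothed SGD -/

/-- The noise of the `i`-th step of the smoothed SGD: the centred value of the smoothed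
indicator. -/
noncomputable def sgdNoise (ν : Measure ℝ) (cγ β a τ y : ℝ) (x : ℕ → ℝ) (i : ℕ) : ℝ :=
  smoothedCDF ν (a * learningRate cγ β i) (smoothedSGD cγ β a τ y x i)
    - smoothStepScaled (a * learningRate cγ β i) (smoothedSGD cγ β a τ y x i - x (i + 1))

/-- Hoeffding's lemma for the centred smoothed indicator. -/
lemma lintegral_exp_noise_le (ν : Measure ℝ) [IsProbabilityMeasure ν] (h y t : ℝ) :
    ∫⁻ u, ENNReal.ofReal (Real.exp (t * (smoothedCDF ν h y - smoothStepScaled h (y - u)))) ∂ν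
      ≤ ENNReal.ofReal (Real.exp (t ^ 2 / 2)) := by
  have hm : Measurable fun u => smoothStepScaled h (y - u) :=
    (measurable_smoothStepScaled h).comp (measurable_const.sub measurable_id)
  have H := hasSubgaussianMGF_of_mem_Icc (μ := ν) (X := fun u => -smoothStepScaled h (y - u))
    (a := -1) (b := 0) hm.neg.aemeasurable (ae_of_all _ fun u =>
      ⟨neg_le_neg (smoothStep_le_one _), neg_nonpos.2 (smoothStep_nonneg _)⟩)
  rw [integral_neg] at H
  have e : (fun u => -smoothStepScaled h (y - u) - -∫ x, smoothStepScaled h (y - x) ∂ν)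
      = fun u => smoothedCDF ν h y - smoothStepScaled h (y - u) := by
    funext u; rw [smoothedCDF]; ring
  rw [e] at H
  rw [← ofReal_integral_eq_lintegral_ofReal (H.integrable_exp_mul t)
    (ae_of_all _ fun _ => (Real.exp_pos _).le)]
  refine ENNReal.ofReal_le_ofReal ((H.mgf_le t).trans ?_)
  rw [Real.exp_le_exp]
  have : (((‖(0 : ℝ) - -1‖₊ / 2) ^ 2 : NNReal) : ℝ) ≤ 1 := by
    norm_num
  gcongr
  nlinarith [sq_nonneg t]

lemma lintegral_exp_add_noise_le {Ω : Type*} [MeasurableSpace Ω] {μ : Measure Ω}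
    [IsProbabilityMeasure μ] {Y S U : Ω → ℝ} (hY : Measurable Y) (hS : Measurable S)
    (hU : Measurable U) (hind : IndepFun (fun ω => (Y ω, S ω)) U μ) {ν : Measure ℝ}
    (hν : μ.map U = ν) (h w l : ℝ) :
    ∫⁻ ω, ENNReal.ofReal (Real.exp (l * (S ω +
        w * (smoothedCDF ν h (Y ω) - smoothStepScaled h (Y ω - U ω))))) ∂μ
      ≤ (∫⁻ ω, ENNReal.ofReal (Real.exp (l * S ω)) ∂μ)
        * ENNReal.ofReal (Real.exp (l ^ 2 * w ^ 2 / 2)) := by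
  have : IsProbabilityMeasure ν := hν ▸ Measure.isProbabilityMeasure_map hU.aemeasurable
  have hYS : Measurable fun ω => (Y ω, S ω) := hY.prodMk hS
  have hprod := (indepFun_iff_map_prod_eq_prod_map_map hYS.aemeasurable hU.aemeasurable).1 hind
  rw [hν] at hprod
  set Φ : (ℝ × ℝ) × ℝ → ENNReal := fun z => ENNReal.ofReal (Real.exp (l * z.1.2)) *
    ENNReal.ofReal (Real.exp (l * w * (smoothedCDF ν h z.1.1 - smoothStepScaled h (z.1.1 - z.2))))
    with hΦ
  have hΦm : Measurable Φ := by
    have h1 := measurable_smoothedCDF ν h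
    have h2 := measurable_smoothStepScaled h
    fun_prop
  calc _ = ∫⁻ ω, Φ ((Y ω, S ω), U ω) ∂μ := by
        refine lintegral_congr fun ω => ?_
        simp only [hΦ]
        rw [← ENNReal.ofReal_mul (Real.exp_pos _).le, ← Real.exp_add]
        congr 2; ring
    _ = ∫⁻ z, Φ z ∂(μ.map fun ω => ((Y ω, S ω), U ω)) :=
        (lintegral_map hΦm (hYS.prodMk hU)).symm
    _ = ∫⁻ p, ∫⁻ u, Φ (p, u) ∂ν ∂(μ.map fun ω => (Y ω, S ω)) := by
        rw [hprod, lintegral_prod _ hΦm.aemeasurable]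
    _ ≤ ∫⁻ p, ENNReal.ofReal (Real.exp (l * p.2)) * ENNReal.ofReal (Real.exp (l ^ 2 * w ^ 2 / 2))
          ∂(μ.map fun ω => (Y ω, S ω)) := by
        refine lintegral_mono fun p => ?_
        simp only [hΦ]
        rw [lintegral_const_mul']
        · gcongr
          refine (lintegral_exp_noise_le ν h p.1 (l * w)).trans_eq ?_
          rw [mul_pow]
        · exact ENNReal.ofReal_ne_top
    _ = ∫⁻ ω, ENNReal.ofReal (Real.exp (l * S ω)) * ENNReal.ofReal (Real.exp (l ^ 2 * w ^ 2 / 2)) ∂μ :=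
        lintegral_map (by fun_prop) hYS
    _ = _ := lintegral_mul_const _ (by fun_prop)

section Concentration

variable {Ω : Type*} [MeasurableSpace Ω] {μ : Measure Ω} [IsProbabilityMeasure μ]
  {X : ℕ → Ω → ℝ} {ν : Measure ℝ}

lemma measurable_natural_smoothedSGD (hXm : ∀ k, StronglyMeasurable (X (k + 1)))
    (cγ β a τ y : ℝ) (k : ℕ) :
    Measurable[Filtration.natural (fun k => X (k + 1)) hXm k]
      (fun ω => smoothedSGD cγ β a τ y (fun t => X t ω) (k + 1)) := by
  induction k with
  | zero => exact measurable_const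
  | succ k ih =>
    have h1 := ih.mono ((Filtration.natural (fun k => X (k + 1)) hXm).mono (Nat.le_succ k)) le_rfl
    have h2 : Measurable[Filtration.natural (fun k => X (k + 1)) hXm (k + 1)] (X (k + 1 + 1)) :=
      (Filtration.stronglyAdapted_natural hXm (k + 1)).measurable
    exact h1.add ((measurable_const.sub
      ((measurable_smoothStepScaled _).comp (h1.sub h2))).const_mul _)

lemma measurable_natural_sum_noise [IsProbabilityMeasure ν]
    (hXm : ∀ k, StronglyMeasurable (X (k + 1)))
    (cγ β a τ y : ℝ) (w : ℕ → ℝ) {j : ℕ} (hj : 1 ≤ j) (k : ℕ) :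
    Measurable[Filtration.natural (fun k => X (k + 1)) hXm k]
      (fun ω => ∑ i ∈ Finset.Ico j (k + 1), w i * sgdNoise ν cγ β a τ y (fun t => X t ω) i) := by
  refine Finset.measurable_fun_sum _ fun i hi => ?_
  simp only [Finset.mem_Ico] at hi
  obtain ⟨i, rfl⟩ : ∃ m, i = m + 1 := ⟨i - 1, by omega⟩
  have h1 := (measurable_natural_smoothedSGD hXm cγ β a τ y i).mono
    ((Filtration.natural (fun k => X (k + 1)) hXm).mono (by omega : i ≤ k)) le_rfl
  have h2 : Measurable[Filtration.natural (fun k => X (k + 1)) hXm k] (X (i + 1 + 1)) :=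
    (Filtration.stronglyAdapted_natural hXm (i + 1)).measurable.mono
      ((Filtration.natural (fun k => X (k + 1)) hXm).mono (by omega : i + 1 ≤ k)) le_rfl
  exact (((measurable_smoothedCDF ν _).comp h1).sub
      ((measurable_smoothStepScaled _).comp (h1.sub h2))).const_mul _

lemma lintegral_exp_sum_noise_le (hXm : ∀ k, Measurable (X (k + 1)))
    (hind : iIndepFun (fun k => X (k + 1)) μ) (hν : ∀ k, μ.map (X (k + 1)) = ν)
    (cγ β a τ y : ℝ) (w : ℕ → ℝ) (l : ℝ) {j : ℕ} (hj : 1 ≤ j) (k : ℕ) :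
    ∫⁻ ω, ENNReal.ofReal (Real.exp (l *
        ∑ i ∈ Finset.Ico j k, w i * sgdNoise ν cγ β a τ y (fun t => X t ω) i)) ∂μ
      ≤ ENNReal.ofReal (Real.exp (l ^ 2 / 2 * ∑ i ∈ Finset.Ico j k, w i ^ 2)) := by
  have hXs : ∀ k, StronglyMeasurable (X (k + 1)) := fun k => (hXm k).stronglyMeasurable
  have : IsProbabilityMeasure ν := hν 0 ▸ Measure.isProbabilityMeasure_map (hXm 0).aemeasurable
  rcases le_or_gt k j with hkj | hkj
  · simp [Finset.Ico_eq_empty_of_le hkj]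
  induction k, hkj.le using Nat.le_induction with
  | base => simp
  | succ k hjk ih =>
    have ih : ∫⁻ ω, ENNReal.ofReal (Real.exp (l *
        ∑ i ∈ Finset.Ico j k, w i * sgdNoise ν cγ β a τ y (fun t => X t ω) i)) ∂μ
      ≤ ENNReal.ofReal (Real.exp (l ^ 2 / 2 * ∑ i ∈ Finset.Ico j k, w i ^ 2)) := by
      rcases hjk.eq_or_lt with h | h
      · simp [h]
      · exact ih h
    obtain ⟨m, rfl⟩ : ∃ m, k = m + 1 := ⟨k - 1, by omega⟩
    have hY := measurable_natural_smoothedSGD hXs cγ β a τ y m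
    have hS := measurable_natural_sum_noise (ν := ν) hXs cγ β a τ y w hj m
    have hle := (Filtration.natural (fun k => X (k + 1)) hXs).le m
    have hI := hind.indep_comap_natural_of_lt hXs (Nat.lt_succ_self m)
    have hI' : IndepFun (fun ω => (smoothedSGD cγ β a τ y (fun t => X t ω) (m + 1),
        ∑ i ∈ Finset.Ico j (m + 1), w i * sgdNoise ν cγ β a τ y (fun t => X t ω) i))
        (X (m + 1 + 1)) μ := by
      rw [IndepFun_iff_Indep]
      exact indep_of_indep_of_le_left hI.symm (hY.prodMk hS).comap_le
    have h1 := lintegral_exp_add_noise_le (hY.mono hle le_rfl) (hS.mono hle le_rfl) (hXm (m + 1))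
      hI' (hν (m + 1)) (a * learningRate cγ β (m + 1)) (w (m + 1)) l
    simp only [Finset.sum_Ico_succ_top hjk]
    refine h1.trans ((mul_le_mul_left ih _).trans_eq ?_)
    rw [← ENNReal.ofReal_mul (Real.exp_pos _).le, ← Real.exp_add]
    congr 2; ring

/-- Azuma's inequality for the weighted noise of the smoothed SGD and its negative (`σ = ±1`). -/
lemma measureReal_sum_noise_le (hXm : ∀ k, Measurable (X (k + 1)))
    (hind : iIndepFun (fun k => X (k + 1)) μ) (hν : ∀ k, μ.map (X (k + 1)) = ν)
    (cγ β a τ y : ℝ) (w : ℕ → ℝ) {σ : ℝ} (hσ : σ ^ 2 = 1) {j : ℕ} (hj : 1 ≤ j) (k : ℕ)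
    {v t : ℝ} (hv : 0 < v) (ht : 0 ≤ t) (hw : ∑ i ∈ Finset.Ico j k, w i ^ 2 ≤ v) :
    μ.real {ω | t ≤ ∑ i ∈ Finset.Ico j k, w i * (σ * sgdNoise ν cγ β a τ y (fun t => X t ω) i)}
      ≤ Real.exp (-(t ^ 2 / (2 * v))) := by
  set S : Ω → ℝ := fun ω =>
    ∑ i ∈ Finset.Ico j k, w i * sgdNoise ν cγ β a τ y (fun t => X t ω) i with hS
  have hSσ : ∀ ω, ∑ i ∈ Finset.Ico j k, w i * (σ * sgdNoise ν cγ β a τ y (fun t => X t ω) i)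
      = σ * S ω := by
    intro ω
    rw [hS, Finset.mul_sum]
    exact Finset.sum_congr rfl fun i _ => by ring
  simp only [hSσ]
  have hXs : ∀ k, StronglyMeasurable (X (k + 1)) := fun k => (hXm k).stronglyMeasurable
  have : IsProbabilityMeasure ν := hν 0 ▸ Measure.isProbabilityMeasure_map (hXm 0).aemeasurable
  have hSm : Measurable S := by
    rcases k with _ | k
    · simp [hS]
    · exact (measurable_natural_sum_noise (ν := ν) hXs cγ β a τ y w hj k).mono
        ((Filtration.natural (fun k => X (k + 1)) hXs).le k) le_rfl
  -- exponential Markov inequality with the optimal parameter `t / v`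
  have h1 := lintegral_exp_sum_noise_le hXm hind hν cγ β a τ y w (t / v * σ) hj k
  have h2 := mul_meas_ge_le_lintegral (μ := μ)
    (f := fun ω => ENNReal.ofReal (Real.exp (t / v * σ * S ω))) (by fun_prop)
    (ENNReal.ofReal (Real.exp (t / v * t)))
  have h3 : {ω | t ≤ σ * S ω} ⊆ {ω | ENNReal.ofReal (Real.exp (t / v * t))
      ≤ ENNReal.ofReal (Real.exp (t / v * σ * S ω))} := by
    intro ω hω
    refine ENNReal.ofReal_le_ofReal (Real.exp_le_exp.2 ?_)
    rw [mul_assoc]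
    exact mul_le_mul_of_nonneg_left hω (by positivity)
  have h4 : ENNReal.ofReal (Real.exp (t / v * t)) * μ {ω | t ≤ σ * S ω}
      ≤ ENNReal.ofReal (Real.exp (t ^ 2 / (2 * v))) := by
    refine (mul_le_mul_right (measure_mono h3) _).trans (h2.trans (h1.trans ?_))
    refine ENNReal.ofReal_le_ofReal (Real.exp_le_exp.2 ?_)
    calc (t / v * σ) ^ 2 / 2 * ∑ i ∈ Finset.Ico j k, w i ^ 2 ≤ (t / v * σ) ^ 2 / 2 * v := by gcongr
      _ = t ^ 2 / (2 * v) := by rw [mul_pow, hσ]; field_simp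
  have h5 := ENNReal.toReal_mono ENNReal.ofReal_ne_top h4
  rw [ENNReal.toReal_mul, ENNReal.toReal_ofReal (Real.exp_pos _).le,
    ENNReal.toReal_ofReal (Real.exp_pos _).le] at h5
  rw [Measure.real, Real.exp_neg, ← one_div, le_div_iff₀ (Real.exp_pos _)]
  have h6 : Real.exp (t / v * t) = Real.exp (t ^ 2 / (2 * v)) * Real.exp (t ^ 2 / (2 * v)) := by
    rw [← Real.exp_add]; congr 1; field_simp; ring
  rw [h6, mul_assoc] at h5
  have h7 := Real.exp_pos (t ^ 2 / (2 * v))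
  have h8 := le_of_mul_le_mul_left (h5.trans_eq (mul_one _).symm) h7
  linarith

end Concentration

/-! ### Linearization of the recursion and summation of the errors -/

lemma smoothedSGD_succ (cγ β a τ y : ℝ) (x : ℕ → ℝ) {k : ℕ} (hk : 1 ≤ k) :
    smoothedSGD cγ β a τ y x (k + 1) = smoothedSGD cγ β a τ y x k + learningRate cγ β k *
      (τ - smoothStepScaled (a * learningRate cγ β k) (smoothedSGD cγ β a τ y x k - x (k + 1))) := by
  obtain ⟨k, rfl⟩ : ∃ m, k = m + 1 := ⟨k - 1, by omega⟩
  rfl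

lemma abs_smoothedSGD_step_le {cγ β a τ y : ℝ} (hcγ : 0 < cγ) (h0 : 0 ≤ τ) (h1 : τ ≤ 1)
    (x : ℕ → ℝ) {k : ℕ} (hk : 1 ≤ k) :
    |smoothedSGD cγ β a τ y x (k + 1) - smoothedSGD cγ β a τ y x k| ≤ learningRate cγ β k := by
  have hg := learningRate_pos (β := β) hcγ hk
  rw [smoothedSGD_succ _ _ _ _ _ _ hk, add_sub_cancel_left, abs_mul, abs_of_pos hg]
  refine mul_le_of_le_one_right hg.le ?_
  unfold smoothStepScaled
  rw [abs_le]
  constructor <;> linarith [smoothStep_nonneg ((smoothedSGD cγ β a τ y x k - x (k + 1)) /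
    (a * learningRate cγ β k)), smoothStep_le_one ((smoothedSGD cγ β a τ y x k - x (k + 1)) /
    (a * learningRate cγ β k))]

lemma sum_learningRate_le {cγ β : ℝ} (hcγ : 0 < cγ) (hβ : 0 < β) (hβ' : β < 1) (n : ℕ) :
    ∑ k ∈ Finset.Icc 1 n, learningRate cγ β k ≤ cγ / (1 - β) * (n : ℝ) ^ (1 - β) := by
  unfold learningRate
  rw [← Finset.mul_sum]
  calc _ ≤ cγ * ((n : ℝ) ^ (1 - β) / (1 - β)) := by
        gcongr
        exact sum_Icc_rpow_neg_le hβ hβ' n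
    _ = _ := by ring

/-- The deterministic growth bound of the iterates. -/
lemma abs_smoothedSGD_sub_le {cγ β a τ y q M cy : ℝ} (hcγ : 0 < cγ) (hβ : 0 < β) (hβ' : β < 1)
    (h0 : 0 ≤ τ) (h1 : τ ≤ 1) (hy : |y| ≤ cy) (hq : |q| ≤ M) (x : ℕ → ℝ) {k : ℕ} (hk : 1 ≤ k) :
    |smoothedSGD cγ β a τ y x k - q| ≤ (cy + M + cγ / (1 - β)) * (k : ℝ) ^ (1 - β) := by
  have h1β : 0 < 1 - β := by linarith
  have key : ∀ m : ℕ, |smoothedSGD cγ β a τ y x (m + 1) - q| ≤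
      cy + M + ∑ i ∈ Finset.Icc 1 m, learningRate cγ β i := by
    intro m
    induction m with
    | zero =>
      simp only [smoothedSGD]
      have := abs_sub y q
      simp only [Finset.Icc_eq_empty_of_lt zero_lt_one, Finset.sum_empty]
      linarith
    | succ m ih =>
      rw [Finset.sum_Icc_succ_top (by omega)]
      have h2 := abs_smoothedSGD_step_le (a := a) (β := β) (y := y) hcγ h0 h1 x
        (Nat.succ_le_succ (Nat.zero_le m))
      have h3 := abs_sub_le (smoothedSGD cγ β a τ y x (m + 1 + 1))
        (smoothedSGD cγ β a τ y x (m + 1)) q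
      simp only [Nat.succ_eq_add_one] at h2
      linarith
  obtain ⟨m, rfl⟩ : ∃ m, k = m + 1 := ⟨k - 1, by omega⟩
  have h2 : (1 : ℝ) ≤ ((m + 1 : ℕ) : ℝ) ^ (1 - β) :=
    Real.one_le_rpow (by exact_mod_cast hk) h1β.le
  have h3 : (m : ℝ) ^ (1 - β) ≤ ((m + 1 : ℕ) : ℝ) ^ (1 - β) :=
    Real.rpow_le_rpow (by positivity) (by push_cast; linarith) h1β.le
  have h4 : 0 ≤ cy + M := add_nonneg ((abs_nonneg _).trans hy) ((abs_nonneg _).trans hq)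
  have h5 : 0 < cγ / (1 - β) := by positivity
  have h6 := sum_learningRate_le hcγ hβ hβ' m
  have h7 := mul_le_mul_of_nonneg_left h3 h5.le
  have h8 := mul_le_mul_of_nonneg_left h2 h4
  linarith [key m]

/-- The deviation `σ (Y - q)`, `σ = ±1`, of the smoothed SGD from the quantile `q` is a drift
process. -/
lemma isDriftProcess_smoothedSGD {Ω : Type*} [MeasurableSpace Ω] {μ : Measure Ω}
    [IsProbabilityMeasure μ] {X : ℕ → Ω → ℝ} {ν : Measure ℝ} {f : ℝ → ℝ}
    {β cγ a τ cL cf M cy q y σ : ℝ}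
    (hβ : 0 < β) (hβ' : β < 1) (hcγ : 0 < cγ) (ha : 0 < a) (h0 : 0 ≤ τ) (h1 : τ ≤ 1)
    (hcL : 0 < cL) (hcf : 0 < cf) (hσ : σ = 1 ∨ σ = -1)
    (hXm : ∀ k, Measurable (X (k + 1))) (hind : iIndepFun (fun k => X (k + 1)) μ)
    (hν : ∀ k, μ.map (X (k + 1)) = ν) (H : HasSmoothDensity ν f cf)
    (hq : ν.real (Set.Iic q) = τ) (hfq : cL ≤ f q) (hqM : |q| ≤ M) (hy : |y| ≤ cy) :
    IsDriftProcess μ β cγ (cL / 2) (cL / (2 * cf)) (cf * a) (cy + M + cγ / (1 - β))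
      (fun k ω => σ * (smoothedSGD cγ β a τ y (fun t => X t ω) k - q))
      (fun k ω => σ * sgdNoise ν cγ β a τ y (fun t => X t ω) k) where
  step ω i hi := by
    have h2 := abs_le.1 (abs_smoothedSGD_step_le (a := a) (β := β) (y := y) hcγ h0 h1
      (fun t => X t ω) hi)
    rcases hσ with rfl | rfl <;> linarith
  drift ω i hi hD := by
    have : IsProbabilityMeasure ν := hν 0 ▸ Measure.isProbabilityMeasure_map (hXm 0).aemeasurable
    have hg := learningRate_pos (β := β) hcγ hi
    have h2 := smoothedSGD_succ cγ β a τ y (fun t => X t ω) hi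
    have h3 := abs_le.1 (H.abs_smoothedCDF_sub_le (mul_pos ha hg)
      (smoothedSGD cγ β a τ y (fun t => X t ω) i))
    simp only [sgdNoise]
    rw [h2]
    set Y := smoothedSGD cγ β a τ y (fun t => X t ω) i
    set γ := learningRate cγ β i
    rcases hσ with rfl | rfl
    · have h4 := H.le_cdf_sub hcf hcL hfq (show q ≤ Y by linarith)
      simp only [one_mul]
      have h5 : cL / 2 * min (Y - q) (cL / (2 * cf)) - cf * a * γ ≤ smoothedCDF ν (a * γ) Y - τ := by
        linarith
      have := mul_le_mul_of_nonneg_left h5 hg.le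
      linarith
    · have h4 := H.le_cdf_sub' hcf hcL hfq (show Y ≤ q by linarith)
      rw [neg_one_mul (Y - q), neg_sub]
      have h5 : cL / 2 * min (q - Y) (cL / (2 * cf)) - cf * a * γ ≤ τ - smoothedCDF ν (a * γ) Y := by
        linarith
      have := mul_le_mul_of_nonneg_left h5 hg.le
      linarith
  growth ω i hi := by
    have h2 := abs_le.1 (abs_smoothedSGD_sub_le (a := a) hcγ hβ hβ' h0 h1 hy hqM
      (fun t => X t ω) hi)
    rcases hσ with rfl | rfl <;> linarith
  conc w j k v t hj hv ht hw := measureReal_sum_noise_le hXm hind hν cγ β a τ y w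
    (by rcases hσ with rfl | rfl <;> norm_num) hj k hv ht hw

lemma rpow_sub_rpow_pred_le {β : ℝ} (hβ : 0 < β) (hβ' : β < 1) {k : ℕ} (hk : 1 ≤ k) :
    |(k : ℝ) ^ β - ((k - 1 : ℕ) : ℝ) ^ β| ≤ (k : ℝ) ^ (β - 1) := by
  have hkp : (0 : ℝ) < k := by exact_mod_cast hk
  have hc : ((k - 1 : ℕ) : ℝ) = k - 1 := by rw [Nat.cast_sub hk]; simp
  have hk0 : (0 : ℝ) ≤ ((k - 1 : ℕ) : ℝ) := by positivity
  have h1 : ((k - 1 : ℕ) : ℝ) ^ β ≤ (k : ℝ) ^ β :=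
    Real.rpow_le_rpow hk0 (by rw [hc]; linarith) hβ.le
  rw [abs_of_nonneg (by linarith)]
  have h2 : ((k - 1 : ℕ) : ℝ) ≤ ((k - 1 : ℕ) : ℝ) ^ β * (k : ℝ) ^ (1 - β) := by
    calc ((k - 1 : ℕ) : ℝ) = ((k - 1 : ℕ) : ℝ) ^ β * ((k - 1 : ℕ) : ℝ) ^ (1 - β) := by
          rw [← Real.rpow_add' hk0 (by simp)]; simp
      _ ≤ _ := by
        gcongr
        omega
  have h3 : (k : ℝ) ^ (1 - β) * (k : ℝ) ^ (β - 1) = 1 := by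
    rw [← Real.rpow_add hkp]; simp
  have h4 : (k : ℝ) ^ β = k * (k : ℝ) ^ (β - 1) := by
    rw [Real.rpow_sub_one hkp.ne']; field_simp
  have h5 : (0 : ℝ) < (k : ℝ) ^ (β - 1) := by positivity
  have h6 := mul_le_mul_of_nonneg_right h2 h5.le
  rw [mul_assoc, h3, hc] at h6
  rw [hc]
  linarith

/-- Summation by parts for the telescoping part of the linearized recursion. -/
lemma abs_sum_sub_mul_rpow_le {β : ℝ} (hβ : 0 < β) (hβ' : β < 1) (D : ℕ → ℝ) (n : ℕ) :
    |∑ k ∈ Finset.Icc 1 n, (D k - D (k + 1)) * (k : ℝ) ^ β| ≤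
      ∑ k ∈ Finset.Icc 1 n, (k : ℝ) ^ (β - 1) * |D k| + (n : ℝ) ^ β * |D (n + 1)| := by
  have h1 : ∑ k ∈ Finset.Icc 1 n, (D k - D (k + 1)) * (k : ℝ) ^ β =
      ∑ k ∈ Finset.Icc 1 n, ((k : ℝ) ^ β - ((k - 1 : ℕ) : ℝ) ^ β) * D k
        - (n : ℝ) ^ β * D (n + 1) := by
    induction n with
    | zero => simp [Real.zero_rpow hβ.ne']
    | succ n ih =>
      rw [Finset.sum_Icc_succ_top (by omega), Finset.sum_Icc_succ_top (by omega), ih,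
        Nat.add_sub_cancel]
      ring
  rw [h1]
  refine (abs_sub _ _).trans (add_le_add ?_ ?_)
  · refine (Finset.abs_sum_le_sum_abs _ _).trans (Finset.sum_le_sum fun k hk => ?_)
    rw [abs_mul]
    exact mul_le_mul_of_nonneg_right (rpow_sub_rpow_pred_le hβ hβ' (Finset.mem_Icc.1 hk).1)
      (abs_nonneg _)
  · rw [abs_mul, abs_of_nonneg (by positivity : (0 : ℝ) ≤ (n : ℝ) ^ β)]

/-- Linearizing the recursion at the quantile `q` and summing expresses the averaged error through
a telescoping part, the noise, the squared errors and the smoothing bias. -/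
lemma abs_averagedSGD_sub_le {ν : Measure ℝ} [IsProbabilityMeasure ν] {f : ℝ → ℝ}
    {β cγ a τ cL cf q y : ℝ} (hβ : 0 < β) (hβ' : β < 1) (hcγ : 0 < cγ) (ha : 0 < a)
    (hcL : 0 < cL) (H : HasSmoothDensity ν f cf)
    (hq : ν.real (Set.Iic q) = τ) (hfq : cL ≤ f q) (x : ℕ → ℝ) {n : ℕ} (hn : 1 ≤ n) :
    cL * n * |averagedSGD cγ β a τ y x n - q| ≤
      (∑ k ∈ Finset.Icc 1 n, (k : ℝ) ^ (β - 1) * |smoothedSGD cγ β a τ y x k - q|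
        + (n : ℝ) ^ β * |smoothedSGD cγ β a τ y x (n + 1) - q|) / cγ
      + |∑ k ∈ Finset.Icc 1 n, sgdNoise ν cγ β a τ y x k|
      + cf * ∑ k ∈ Finset.Icc 1 n, (smoothedSGD cγ β a τ y x k - q) ^ 2
      + cf * a * ∑ k ∈ Finset.Icc 1 n, learningRate cγ β k := by
  have hnp : (0 : ℝ) < n := by exact_mod_cast hn
  set D : ℕ → ℝ := fun k => smoothedSGD cγ β a τ y x k - q with hD
  set r : ℕ → ℝ := fun k => f q * D k -
    (smoothedCDF ν (a * learningRate cγ β k) (smoothedSGD cγ β a τ y x k) - τ) with hr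
  have hstep : ∀ k ∈ Finset.Icc 1 n, f q * D k = (D k - D (k + 1)) * (k : ℝ) ^ β / cγ
      + sgdNoise ν cγ β a τ y x k + r k := by
    intro k hk
    have hk1 := (Finset.mem_Icc.1 hk).1
    have hkp : (0 : ℝ) < k := by exact_mod_cast hk1
    have hg := learningRate_pos (β := β) hcγ hk1
    have h1 : (D k - D (k + 1)) * (k : ℝ) ^ β / cγ = (D k - D (k + 1)) / learningRate cγ β k := by
      rw [learningRate, Real.rpow_neg hkp.le]
      field_simp
    have h2 : (D k - D (k + 1)) / learningRate cγ β k =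
        smoothStepScaled (a * learningRate cγ β k) (smoothedSGD cγ β a τ y x k - x (k + 1)) - τ := by
      rw [div_eq_iff hg.ne']
      simp only [hD]
      rw [smoothedSGD_succ _ _ _ _ _ _ hk1]
      ring
    rw [h1, h2]
    simp only [hr, sgdNoise]
    ring
  have hrle : ∀ k ∈ Finset.Icc 1 n, |r k| ≤ cf * D k ^ 2 + cf * a * learningRate cγ β k := by
    intro k hk
    have hg := learningRate_pos (β := β) hcγ (Finset.mem_Icc.1 hk).1
    have h1 := abs_le.1 (H.abs_smoothedCDF_sub_le (mul_pos ha hg) (smoothedSGD cγ β a τ y x k))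
    have h2 := abs_le.1 (H.abs_cdf_linearization_le q (smoothedSGD cγ β a τ y x k))
    simp only [hr, hD]
    rw [abs_le]
    constructor <;> linarith
  have hsum : f q * n * (averagedSGD cγ β a τ y x n - q) =
      (∑ k ∈ Finset.Icc 1 n, (D k - D (k + 1)) * (k : ℝ) ^ β) / cγ
        + ∑ k ∈ Finset.Icc 1 n, sgdNoise ν cγ β a τ y x k + ∑ k ∈ Finset.Icc 1 n, r k := by
    rw [Finset.sum_div, ← Finset.sum_add_distrib, ← Finset.sum_add_distrib,
      ← Finset.sum_congr rfl hstep, ← Finset.mul_sum]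
    simp only [hD, averagedSGD, Finset.sum_sub_distrib, Finset.sum_const, Nat.card_Icc,
      Nat.add_sub_cancel, nsmul_eq_mul]
    field_simp
  have h1 : cL * n * |averagedSGD cγ β a τ y x n - q| ≤
      |f q * n * (averagedSGD cγ β a τ y x n - q)| := by
    rw [abs_mul, abs_of_pos (mul_pos (hcL.trans_le hfq) hnp)]
    gcongr
  have h2 : |(∑ k ∈ Finset.Icc 1 n, (D k - D (k + 1)) * (k : ℝ) ^ β) / cγ| ≤
      (∑ k ∈ Finset.Icc 1 n, (k : ℝ) ^ (β - 1) * |D k| + (n : ℝ) ^ β * |D (n + 1)|) / cγ := by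
    rw [abs_div, abs_of_pos hcγ]
    gcongr
    exact abs_sum_sub_mul_rpow_le hβ hβ' D n
  have h3 : |∑ k ∈ Finset.Icc 1 n, r k| ≤ cf * ∑ k ∈ Finset.Icc 1 n, D k ^ 2
      + cf * a * ∑ k ∈ Finset.Icc 1 n, learningRate cγ β k := by
    refine (Finset.abs_sum_le_sum_abs _ _).trans ((Finset.sum_le_sum hrle).trans_eq ?_)
    rw [Finset.sum_add_distrib, Finset.mul_sum, Finset.mul_sum]
  refine h1.trans ?_
  rw [hsum]
  refine (abs_add_three _ _ _).trans ?_
  linarith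

lemma sum_Icc_ite_le {z c : ℝ} (hz : 0 ≤ z) (hc : 0 ≤ c) (n : ℕ) :
    ∑ k ∈ Finset.Icc 1 n, (if (k : ℝ) ≤ z then c else 0) ≤ c * z := by
  rw [← Finset.sum_filter, Finset.sum_const, nsmul_eq_mul, mul_comm]
  refine mul_le_mul_of_nonneg_left ?_ hc
  calc _ ≤ ((Finset.Icc 1 ⌊z⌋₊).card : ℝ) := by
        exact_mod_cast Finset.card_le_card fun k hk => by
          simp only [Finset.mem_filter, Finset.mem_Icc] at hk ⊢
          exact ⟨hk.1.1, Nat.le_floor hk.2⟩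
    _ ≤ z := by simpa using Nat.floor_le hz

/-- Sums of errors that are at most `ρ (n / k) ^ (β / 2)`, except possibly for indices `k ≤ z`,
where only the deterministic growth bound is available. -/
lemma sum_errors_le {β R ρ z : ℝ} (hβ : 1 / 2 < β) (hβ' : β < 1) (hR : 0 < R) (hρ : 0 ≤ ρ)
    (hz : 0 ≤ z) {D : ℕ → ℝ} {n : ℕ} (hn : 1 ≤ n)
    (h : ∀ k : ℕ, 1 ≤ k → k ≤ n + 1 → |D k| ≤ ρ * (n : ℝ) ^ (β / 2) * (k : ℝ) ^ (-(β / 2)) ∨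
      ((k : ℝ) ≤ z ∧ |D k| ≤ R * (k : ℝ) ^ (1 - β))) :
    ∑ k ∈ Finset.Icc 1 n, (k : ℝ) ^ (β - 1) * |D k| + (n : ℝ) ^ β * |D (n + 1)| ≤
        (2 / β + 1) * (ρ * (n : ℝ) ^ β) + 2 * R * z ∧
      ∑ k ∈ Finset.Icc 1 n, D k ^ 2 ≤ ρ ^ 2 * n / (1 - β) + R ^ 2 * z ^ 2 := by
  have hnp : (0 : ℝ) < n := by exact_mod_cast hn
  have hβ0 : 0 < β := by linarith
  have h1β : 0 < 1 - β := by linarith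
  have hn2 : (n : ℝ) ^ (β / 2) * (n : ℝ) ^ (β / 2) = (n : ℝ) ^ β := by
    rw [← Real.rpow_add hnp]; ring_nf
  refine ⟨?_, ?_⟩
  · have h1 : ∑ k ∈ Finset.Icc 1 n, (k : ℝ) ^ (β - 1) * |D k| ≤
        ∑ k ∈ Finset.Icc 1 n, (ρ * (n : ℝ) ^ (β / 2) * (k : ℝ) ^ (-(1 - β / 2))
          + if (k : ℝ) ≤ z then R else 0) := by
      refine Finset.sum_le_sum fun k hk => ?_
      simp only [Finset.mem_Icc] at hk
      have hkp : (0 : ℝ) < k := by exact_mod_cast hk.1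
      rcases h k hk.1 (by omega) with h2 | ⟨h2, h3⟩
      · have e : (k : ℝ) ^ (β - 1) * (ρ * (n : ℝ) ^ (β / 2) * (k : ℝ) ^ (-(β / 2)))
            = ρ * (n : ℝ) ^ (β / 2) * (k : ℝ) ^ (-(1 - β / 2)) := by
          have : (k : ℝ) ^ (-(1 - β / 2)) = (k : ℝ) ^ (β - 1) * (k : ℝ) ^ (-(β / 2)) := by
            rw [← Real.rpow_add hkp]; ring_nf
          rw [this]; ring
        have h4 : (0 : ℝ) ≤ if (k : ℝ) ≤ z then R else 0 := by split_ifs <;> linarith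
        have h5 := mul_le_mul_of_nonneg_left h2 (by positivity : (0 : ℝ) ≤ (k : ℝ) ^ (β - 1))
        linarith
      · rw [if_pos h2]
        have e : (k : ℝ) ^ (β - 1) * (R * (k : ℝ) ^ (1 - β)) = R := by
          rw [mul_left_comm, ← Real.rpow_add hkp]; simp
        have h5 := mul_le_mul_of_nonneg_left h3 (by positivity : (0 : ℝ) ≤ (k : ℝ) ^ (β - 1))
        have h6 : 0 ≤ ρ * (n : ℝ) ^ (β / 2) * (k : ℝ) ^ (-(1 - β / 2)) := by positivity
        linarith
    have h2 : ∑ k ∈ Finset.Icc 1 n, (ρ * (n : ℝ) ^ (β / 2) * (k : ℝ) ^ (-(1 - β / 2))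
          + if (k : ℝ) ≤ z then R else 0) ≤ 2 / β * (ρ * (n : ℝ) ^ β) + R * z := by
      rw [Finset.sum_add_distrib, ← Finset.mul_sum]
      refine add_le_add ?_ (sum_Icc_ite_le hz hR.le n)
      calc _ ≤ ρ * (n : ℝ) ^ (β / 2) * ((n : ℝ) ^ (1 - (1 - β / 2)) / (1 - (1 - β / 2))) := by
            gcongr
            exact sum_Icc_rpow_neg_le (by linarith) (by linarith) n
        _ = ρ * ((n : ℝ) ^ (β / 2) * (n : ℝ) ^ (β / 2)) * (2 / β) := by
          rw [show 1 - (1 - β / 2) = β / 2 by ring]; field_simp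
        _ = _ := by rw [hn2]; ring
    have h3 : (n : ℝ) ^ β * |D (n + 1)| ≤ ρ * (n : ℝ) ^ β + R * z := by
      have hn1 : (n : ℝ) ≤ ((n + 1 : ℕ) : ℝ) := by push_cast; linarith
      rcases h (n + 1) (by omega) le_rfl with h2 | ⟨h2, h3⟩
      · calc (n : ℝ) ^ β * |D (n + 1)|
            ≤ (n : ℝ) ^ β * (ρ * (n : ℝ) ^ (β / 2) * (n : ℝ) ^ (-(β / 2))) := by
              have := Real.rpow_le_rpow_of_nonpos hnp hn1 (by linarith : -(β / 2) ≤ 0)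
              refine mul_le_mul_of_nonneg_left (h2.trans ?_) (by positivity)
              gcongr
          _ = ρ * (n : ℝ) ^ β := by
            rw [mul_assoc ρ, ← Real.rpow_add hnp]; simp; ring
          _ ≤ _ := by
            have : 0 ≤ R * z := by positivity
            linarith
      · calc (n : ℝ) ^ β * |D (n + 1)|
            ≤ ((n + 1 : ℕ) : ℝ) ^ β * (R * ((n + 1 : ℕ) : ℝ) ^ (1 - β)) := by gcongr
          _ = R * ((n + 1 : ℕ) : ℝ) := by
            rw [mul_left_comm, ← Real.rpow_add (by positivity)]; simp
          _ ≤ R * z := by gcongr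
          _ ≤ _ := by
            have : 0 ≤ ρ * (n : ℝ) ^ β := by positivity
            linarith
    linarith
  · have h1 : ∑ k ∈ Finset.Icc 1 n, D k ^ 2 ≤
        ∑ k ∈ Finset.Icc 1 n, (ρ ^ 2 * (n : ℝ) ^ β * (k : ℝ) ^ (-β)
          + if (k : ℝ) ≤ z then R ^ 2 * z else 0) := by
      refine Finset.sum_le_sum fun k hk => ?_
      simp only [Finset.mem_Icc] at hk
      have hkp : (0 : ℝ) < k := by exact_mod_cast hk.1
      have hk1 : (1 : ℝ) ≤ k := by exact_mod_cast hk.1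
      rw [← sq_abs]
      rcases h k hk.1 (by omega) with h2 | ⟨h2, h3⟩
      · have e : (ρ * (n : ℝ) ^ (β / 2) * (k : ℝ) ^ (-(β / 2))) ^ 2
            = ρ ^ 2 * (n : ℝ) ^ β * (k : ℝ) ^ (-β) := by
          have : (k : ℝ) ^ (-β) = (k : ℝ) ^ (-(β / 2)) * (k : ℝ) ^ (-(β / 2)) := by
            rw [← Real.rpow_add hkp]; ring_nf
          rw [this, ← hn2]; ring
        have h4 : (0 : ℝ) ≤ if (k : ℝ) ≤ z then R ^ 2 * z else 0 := by
          split_ifs <;> positivity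
        have h5 := pow_le_pow_left₀ (abs_nonneg _) h2 2
        linarith
      · rw [if_pos h2]
        have e : (R * (k : ℝ) ^ (1 - β)) ^ 2 ≤ R ^ 2 * z := by
          rw [mul_pow]
          have h4 : ((k : ℝ) ^ (1 - β)) ^ 2 ≤ k := by
            rw [← Real.rpow_natCast, ← Real.rpow_mul hkp.le]
            simpa using Real.rpow_le_rpow_of_exponent_le hk1
              (show (1 - β) * ((2 : ℕ) : ℝ) ≤ 1 by push_cast; linarith)
          gcongr
          linarith
        have h5 := pow_le_pow_left₀ (abs_nonneg _) h3 2
        have h6 : 0 ≤ ρ ^ 2 * (n : ℝ) ^ β * (k : ℝ) ^ (-β) := by positivity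
        linarith
    refine h1.trans ?_
    rw [Finset.sum_add_distrib, ← Finset.mul_sum]
    refine add_le_add ?_ ((sum_Icc_ite_le hz (by positivity) n).trans_eq (by ring))
    calc _ ≤ ρ ^ 2 * (n : ℝ) ^ β * ((n : ℝ) ^ (1 - β) / (1 - β)) := by
          gcongr
          exact sum_Icc_rpow_neg_le hβ0 hβ' n
      _ = ρ ^ 2 * ((n : ℝ) ^ β * (n : ℝ) ^ (1 - β)) / (1 - β) := by ring
      _ = _ := by rw [← Real.rpow_add hnp]; simp

/-! ### The tail bound at a single quantile level -/

/-- The sum of the three leading terms of the tail bound for the averaged smoothed SGD. -/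
noncomputable def sgdTailBound (β b₁ b₂ b₃ : ℝ) (n : ℕ) (x : ℝ) : ℝ :=
  Real.exp (-b₁ * n * x ^ 2) + n * Real.exp (-b₂ * (n : ℝ) ^ β * x)
    + (n : ℝ) ^ (2 + β) * Real.exp (-b₃ * (n : ℝ) ^ (β * (1 - β)) * x ^ (1 / 4 : ℝ))

/-- If the iterates are close to the quantile from time `z = η √(n x)` on and the noise averages
out, then the averaged iterate is within `x` of the quantile. -/
lemma abs_averagedSGD_sub_le_of_errors {ν : Measure ℝ} [IsProbabilityMeasure ν] {f : ℝ → ℝ}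
    {β cγ a τ cL cf q y R η κ ρ x : ℝ} (hβ : 1 / 2 < β) (hβ' : β < 1) (hcγ : 0 < cγ) (ha : 0 < a)
    (hcL : 0 < cL) (hcf : 0 < cf) (H : HasSmoothDensity ν f cf)
    (hq : ν.real (Set.Iic q) = τ) (hfq : cL ≤ f q) (hR : 0 < R)
    (hη : 0 < η) (hη1 : η ≤ 1)
    (hηc : η * ((2 / β + 1 + 2 * R) / cγ + cf / (1 - β) + cf * R ^ 2) ≤ cL / 4)
    (hκ1 : 1 ≤ κ) (hκ : cf * a * (cγ / (1 - β)) ≤ cL / 4 * κ)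
    {n : ℕ} (hn : 1 ≤ n) (hx : 0 < x) (hnx : κ ≤ x * √n)
    (hρ0 : 0 ≤ ρ) (hρ1 : ρ ≤ η * x * (n : ℝ) ^ (1 - β)) (hρ2 : ρ ≤ η * √x) (d : ℕ → ℝ)
    (hnoise : |∑ k ∈ Finset.Icc 1 n, sgdNoise ν cγ β a τ y d k| ≤ cL * n * x / 4)
    (herr : ∀ k : ℕ, 1 ≤ k → k ≤ n + 1 → |smoothedSGD cγ β a τ y d k - q|
        ≤ ρ * (n : ℝ) ^ (β / 2) * (k : ℝ) ^ (-(β / 2)) ∨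
      ((k : ℝ) ≤ η * √(n * x) ∧
        |smoothedSGD cγ β a τ y d k - q| ≤ R * (k : ℝ) ^ (1 - β))) :
    |averagedSGD cγ β a τ y d n - q| ≤ x := by
  have hnp : (0 : ℝ) < n := by exact_mod_cast hn
  have hn1 : (1 : ℝ) ≤ n := by exact_mod_cast hn
  have hβ0 : 0 < β := by linarith
  have h1β : 0 < 1 - β := by linarith
  have hsn : √(n : ℝ) * √n = n := Real.mul_self_sqrt hnp.le
  have hsn1 : 1 ≤ √(n : ℝ) := Real.one_le_sqrt.2 hn1
  have hnx2 : κ * √n ≤ n * x := by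
    calc κ * √n ≤ x * √n * √n := by gcongr
      _ = n * x := by rw [mul_assoc, hsn, mul_comm]
  have hnx1 : 1 ≤ n * x := le_trans (one_le_mul_of_one_le_of_one_le hκ1 hsn1) hnx2
  have hnxp : (0 : ℝ) < n * x := by linarith
  have hz2 : √((n : ℝ) * x) * √(n * x) = n * x := Real.mul_self_sqrt hnxp.le
  have hz1 : √((n : ℝ) * x) ≤ n * x := by
    exact (le_mul_of_one_le_left (Real.sqrt_nonneg _) (Real.one_le_sqrt.2 hnx1)).trans_eq hz2
  obtain ⟨h1, h2⟩ := sum_errors_le (D := fun k => smoothedSGD cγ β a τ y d k - q) hβ hβ' hR hρ0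
    (by positivity : 0 ≤ η * √(n * x)) hn herr
  have h3 := abs_averagedSGD_sub_le (cγ := cγ) (a := a) (y := y) hβ0 hβ' hcγ ha hcL H hq hfq d hn
  have i1 : ρ * (n : ℝ) ^ β ≤ η * (n * x) := by
    calc ρ * (n : ℝ) ^ β ≤ η * x * (n : ℝ) ^ (1 - β) * (n : ℝ) ^ β := by gcongr
      _ = η * (n * x) := by
        rw [mul_assoc _ ((n : ℝ) ^ (1 - β)), ← Real.rpow_add hnp]; simp; ring
  have i2 : ρ ^ 2 * n ≤ η * (n * x) := by
    calc ρ ^ 2 * n ≤ (η * √x) ^ 2 * n := by gcongr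
      _ = η * (η * (n * x)) := by rw [mul_pow, Real.sq_sqrt hx.le]; ring
      _ ≤ 1 * (η * (n * x)) := by gcongr
      _ = _ := one_mul _
  have i3 : η * √(n * x) ≤ η * (n * x) := by gcongr
  have i4 : (η * √(n * x)) ^ 2 ≤ η * (n * x) := by
    calc (η * √(n * x)) ^ 2 = η * (η * (√(n * x) * √(n * x))) := by ring
      _ ≤ 1 * (η * (√(n * x) * √(n * x))) := by gcongr
      _ = _ := by rw [hz2, one_mul]
  have i5 : cf * a * ∑ k ∈ Finset.Icc 1 n, learningRate cγ β k ≤ cL / 4 * (n * x) := by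
    have j1 : (n : ℝ) ^ (1 - β) ≤ √n := by
      rw [Real.sqrt_eq_rpow]
      exact Real.rpow_le_rpow_of_exponent_le hn1 (by linarith)
    calc _ ≤ cf * a * (cγ / (1 - β) * (n : ℝ) ^ (1 - β)) := by
          gcongr
          exact sum_learningRate_le hcγ hβ0 hβ' n
      _ ≤ cf * a * (cγ / (1 - β)) * √n := by
        rw [mul_assoc (cf * a)]
        gcongr
      _ ≤ cL / 4 * κ * √n := by gcongr
      _ = cL / 4 * (κ * √n) := by ring
      _ ≤ _ := by gcongr
  have i6 : (∑ k ∈ Finset.Icc 1 n, (k : ℝ) ^ (β - 1) * |smoothedSGD cγ β a τ y d k - q|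
        + (n : ℝ) ^ β * |smoothedSGD cγ β a τ y d (n + 1) - q|) / cγ
      ≤ ((2 / β + 1) * (η * (n * x)) + 2 * R * (η * (n * x))) / cγ := by
    refine div_le_div_of_nonneg_right (h1.trans ?_) hcγ.le
    gcongr
  have i7 : cf * ∑ k ∈ Finset.Icc 1 n, (smoothedSGD cγ β a τ y d k - q) ^ 2
      ≤ cf * (η * (n * x) / (1 - β) + R ^ 2 * (η * (n * x))) := by
    gcongr
    refine h2.trans ?_
    gcongr
  have i8 : ((2 / β + 1) * (η * (n * x)) + 2 * R * (η * (n * x))) / cγ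
      + cf * (η * (n * x) / (1 - β) + R ^ 2 * (η * (n * x))) ≤ cL / 4 * (n * x) := by
    calc _ = η * ((2 / β + 1 + 2 * R) / cγ + cf / (1 - β) + cf * R ^ 2) * (n * x) := by
          field_simp
          ring
      _ ≤ _ := by gcongr
  have h4 : cL * n * |averagedSGD cγ β a τ y d n - q| ≤ cL * n * x := by linarith [mul_pos hcL hnxp]
  exact le_of_mul_le_mul_left h4 (mul_pos hcL hnp)

lemma rpow_mul_rpow_le_mul_rpow {β x : ℝ} {n : ℕ} (hβ : 1 / 2 < β) (hn : 1 ≤ n) (hx : 0 < x)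
    (hnx : 1 ≤ n * x) :
    (n : ℝ) ^ (β * (1 - β)) * x ^ (1 / 4 : ℝ) ≤ √(n * x) ^ β := by
  have hnp : (0 : ℝ) < n := by exact_mod_cast hn
  have hn1 : (1 : ℝ) ≤ n := by exact_mod_cast hn
  have h1 : 1 ≤ ((n : ℝ) ^ β * x ^ (1 / 2 : ℝ)) ^ (β - 1 / 2) := by
    refine Real.one_le_rpow ?_ (by linarith)
    calc (1 : ℝ) ≤ (n * x) ^ (1 / 2 : ℝ) := Real.one_le_rpow hnx (by norm_num)
      _ = (n : ℝ) ^ (1 / 2 : ℝ) * x ^ (1 / 2 : ℝ) := Real.mul_rpow hnp.le hx.le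
      _ ≤ _ := by gcongr
  calc _ ≤ (n : ℝ) ^ (β * (1 - β)) * x ^ (1 / 4 : ℝ) *
        ((n : ℝ) ^ β * x ^ (1 / 2 : ℝ)) ^ (β - 1 / 2) := le_mul_of_one_le_right (by positivity) h1
    _ = ((n : ℝ) ^ (β * (1 - β)) * (n : ℝ) ^ (β * (β - 1 / 2))) *
        (x ^ (1 / 4 : ℝ) * x ^ (1 / 2 * (β - 1 / 2))) := by
      rw [Real.mul_rpow (by positivity) (by positivity), ← Real.rpow_mul hnp.le,
        ← Real.rpow_mul hx.le]
      ring
    _ = (n : ℝ) ^ (β / 2) * x ^ (β / 2) := by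
      rw [← Real.rpow_add hnp, ← Real.rpow_add hx]
      congr 2 <;> ring
    _ = _ := by
      rw [Real.sqrt_eq_rpow, ← Real.rpow_mul (by positivity), ← Real.mul_rpow hnp.le hx.le]
      congr 1; ring

/-- The union bound behind the tail estimate of the average: its error exceeds `x` only if the
averaged noise is large or some iterate after time `η √(n x)` is far from the quantile. -/
lemma measureReal_averagedSGD_le {Ω : Type*} [MeasurableSpace Ω] {μ : Measure Ω}
    [IsProbabilityMeasure μ] {X : ℕ → Ω → ℝ} {ν : Measure ℝ} {f : ℝ → ℝ}
    {β cγ a τ cL cf M cy q y η κ ρ x C b : ℝ}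
    (hβ : 1 / 2 < β) (hβ' : β < 1) (hcγ : 0 < cγ) (ha : 0 < a) (h0 : 0 ≤ τ) (h1 : τ ≤ 1)
    (hcL : 0 < cL) (hcf : 0 < cf) (hM : 0 < M) (hcy : 0 ≤ cy)
    (hXm : ∀ k, Measurable (X (k + 1))) (hind : iIndepFun (fun k => X (k + 1)) μ)
    (hν : ∀ k, μ.map (X (k + 1)) = ν) (H : HasSmoothDensity ν f cf)
    (hq : ν.real (Set.Iic q) = τ) (hfq : cL ≤ f q) (hqM : |q| ≤ M) (hy : |y| ≤ cy)
    (hη : 0 < η) (hη1 : η ≤ 1)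
    (hηc : η * ((2 / β + 1 + 2 * (cy + M + cγ / (1 - β))) / cγ + cf / (1 - β)
      + cf * (cy + M + cγ / (1 - β)) ^ 2) ≤ cL / 4)
    (hκ1 : 1 ≤ κ) (hκ : cf * a * (cγ / (1 - β)) ≤ cL / 4 * κ)
    (hC : 0 < C) (hb : 0 < b)
    (htail : ∀ D ξ : ℕ → Ω → ℝ, IsDriftProcess μ β cγ (cL / 2) (cL / (2 * cf)) (cf * a)
        (cy + M + cγ / (1 - β)) D ξ → ∀ k : ℕ, 1 ≤ k → ∀ u : ℝ, 0 < u → μ.real {ω | u < D k ω} ≤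
        C * (k * Real.exp (-(b * ((k : ℝ) ^ β * u ^ 2))) + Real.exp (-(b * (k : ℝ) ^ β))))
    {n : ℕ} (hn : 1 ≤ n) (hx : 0 < x) (hnx : κ ≤ x * √n)
    (hρ0 : 0 < ρ) (hρ1 : ρ ≤ η * x * (n : ℝ) ^ (1 - β)) (hρ2 : ρ ≤ η * √x) :
    μ.real {ω | x < |averagedSGD cγ β a τ y (fun t => X t ω) n - q|} ≤
      2 * Real.exp (-(cL ^ 2 / 32 * (n * x ^ 2))) + 8 * C * (n ^ 2 *
        Real.exp (-(b * (ρ ^ 2 * (n : ℝ) ^ β)))) +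
        4 * C * (n * Real.exp (-(b * (η ^ β * √(n * x) ^ β)))) := by
  have hnp : (0 : ℝ) < n := by exact_mod_cast hn
  have hn1 : (1 : ℝ) ≤ n := by exact_mod_cast hn
  have hβ0 : 0 < β := by linarith
  have h1β : 0 < 1 - β := by linarith
  have hνp : IsProbabilityMeasure ν := hν 0 ▸ Measure.isProbabilityMeasure_map (hXm 0).aemeasurable
  have hP : ∀ σ : ℝ, σ = 1 ∨ σ = -1 → _ := fun σ hσ =>
    isDriftProcess_smoothedSGD (a := a) hβ0 hβ' hcγ ha h0 h1 hcL hcf hσ hXm hind hν H hq hfq hqM hy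
  have hnoise : ∀ σ : ℝ, σ = 1 ∨ σ = -1 → μ.real {ω | cL * n * x / 4 ≤
      ∑ i ∈ Finset.Ico 1 (n + 1), 1 * (σ * sgdNoise ν cγ β a τ y (fun t => X t ω) i)} ≤
      Real.exp (-(cL ^ 2 / 32 * (n * x ^ 2))) := by
    intro σ hσ
    refine ((hP σ hσ).conc (fun _ => 1) 1 (n + 1) n _ le_rfl hnp (by positivity)
      (by simp)).trans_eq ?_
    congr 2; field_simp; ring
  set u : ℕ → ℝ := fun k => ρ * (n : ℝ) ^ (β / 2) * (k : ℝ) ^ (-(β / 2)) with hu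
  set c := 2 * C * (2 * n * Real.exp (-(b * (ρ ^ 2 * (n : ℝ) ^ β)))
    + Real.exp (-(b * (η ^ β * √(n * x) ^ β)))) with hc
  have hc0 : 0 ≤ c := by positivity
  have hdev : ∀ k : ℕ, 1 ≤ k → k < n + 2 → μ.real {ω | η * √(n * x) < k ∧
      u k < |smoothedSGD cγ β a τ y (fun t => X t ω) k - q|} ≤ c := by
    intro k hk hkn
    have hkp : (0 : ℝ) < k := by exact_mod_cast hk
    rcases le_or_gt (k : ℝ) (η * √(n * x)) with hkz | hkz
    · simp only [not_lt.2 hkz, false_and]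
      simpa using hc0
    have hup : 0 < u k := by simp only [hu]; positivity
    have hone : ∀ σ : ℝ, σ = 1 ∨ σ = -1 → μ.real {ω | u k <
        σ * (smoothedSGD cγ β a τ y (fun t => X t ω) k - q)} ≤ c / 2 := by
      intro σ hσ
      refine (htail _ _ (hP σ hσ) k hk (u k) hup).trans ?_
      have e1 : (k : ℝ) ^ β * u k ^ 2 = ρ ^ 2 * (n : ℝ) ^ β := by
        have e2 : ∀ s : ℝ, 0 < s → (s ^ (β / 2)) ^ 2 = s ^ β := fun s hs => by
          rw [← Real.rpow_natCast, ← Real.rpow_mul hs.le]; congr 1; push_cast; ring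
        simp only [hu]
        rw [mul_pow, mul_pow, e2 _ hnp, Real.rpow_neg hkp.le, inv_pow, e2 _ hkp]
        have : (k : ℝ) ^ β ≠ 0 := by positivity
        field_simp
      have hk2 : (k : ℝ) ≤ 2 * n := by
        have : k ≤ 2 * n := by omega
        exact_mod_cast this
      have e3 : η ^ β * √(n * x) ^ β ≤ (k : ℝ) ^ β := by
        rw [← Real.mul_rpow hη.le (Real.sqrt_nonneg _)]
        gcongr
      rw [e1, hc, mul_assoc 2 C, mul_div_cancel_left₀ _ two_ne_zero]
      gcongr
    have hsub : {ω | η * √(n * x) < k ∧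
        u k < |smoothedSGD cγ β a τ y (fun t => X t ω) k - q|} ⊆
        {ω | u k < 1 * (smoothedSGD cγ β a τ y (fun t => X t ω) k - q)} ∪
        {ω | u k < -1 * (smoothedSGD cγ β a τ y (fun t => X t ω) k - q)} := by
      rintro ω ⟨-, h⟩
      rcases lt_abs.1 h with h | h
      · left; simpa using h
      · right; simpa using h
    refine (measureReal_mono hsub).trans ((measureReal_union_le _ _).trans ?_)
    linarith [hone 1 (Or.inl rfl), hone (-1) (Or.inr rfl)]
  have hsub : {ω | x < |averagedSGD cγ β a τ y (fun t => X t ω) n - q|} ⊆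
      ({ω | cL * n * x / 4 ≤
        ∑ i ∈ Finset.Ico 1 (n + 1), 1 * (1 * sgdNoise ν cγ β a τ y (fun t => X t ω) i)} ∪
      {ω | cL * n * x / 4 ≤
        ∑ i ∈ Finset.Ico 1 (n + 1), 1 * (-1 * sgdNoise ν cγ β a τ y (fun t => X t ω) i)}) ∪
      ⋃ k ∈ Finset.Ico 1 (n + 2), {ω | η * √(n * x) < k ∧
        u k < |smoothedSGD cγ β a τ y (fun t => X t ω) k - q|} := by
    intro ω hω
    by_contra hcon
    simp only [Set.mem_union, Set.mem_iUnion, not_or, not_exists, Set.mem_ofPred_eq, not_le,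
      one_mul, neg_one_mul, Finset.sum_neg_distrib, Finset.mem_Ico, not_and, not_lt] at hcon
    obtain ⟨⟨g1, g2⟩, g3⟩ := hcon
    refine absurd (show x < _ from hω) (not_lt.2 ?_)
    refine abs_averagedSGD_sub_le_of_errors hβ hβ' hcγ ha hcL hcf H hq hfq (by positivity)
      hη hη1 hηc hκ1 hκ hn hx hnx hρ0.le hρ1 hρ2 _ ?_ fun k hk hkn => ?_
    · change |∑ i ∈ Finset.Ico 1 (n + 1), _| ≤ _
      rw [abs_le]
      constructor <;> linarith
    · rcases le_or_gt (k : ℝ) (η * √(n * x)) with hkz | hkz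
      · exact Or.inr ⟨hkz, abs_smoothedSGD_sub_le hcγ hβ0 hβ' h0 h1 hy hqM _ hk⟩
      · exact Or.inl (g3 k ⟨hk, by omega⟩ hkz)
  refine (measureReal_mono hsub).trans ((measureReal_union_le _ _).trans ((add_le_add
    ((measureReal_union_le _ _).trans (add_le_add (hnoise 1 (Or.inl rfl)) (hnoise (-1) (Or.inr rfl))))
    (measureReal_biUnion_Ico_le μ hdev)).trans ?_))
  have h2 : ((n + 2 - 1 : ℕ) : ℝ) ≤ 2 * n := by
    have : n + 2 - 1 ≤ 2 * n := by omega
    exact_mod_cast this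
  have h3 := mul_le_mul_of_nonneg_right h2 hc0
  have h4 : 2 * n * c = 8 * C * (n ^ 2 * Real.exp (-(b * (ρ ^ 2 * (n : ℝ) ^ β)))) +
        4 * C * (n * Real.exp (-(b * (η ^ β * √(n * x) ^ β)))) := by
    rw [hc]; ring
  linarith

/-- The tail bound for the averaged smoothed SGD at a single quantile level. -/
theorem exists_averagedSGD_tail {β cγ a cL cf M cy : ℝ}
    (hβ : 1 / 2 < β) (hβ' : β < 1) (hcγ : 0 < cγ) (ha : 0 < a)
    (hcL : 0 < cL) (hcf : 0 < cf) (hM : 0 < M) (hcy : 0 ≤ cy) :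
    ∃ C b₁ b₂ b₃ : ℝ, 0 < C ∧ 0 < b₁ ∧ 0 < b₂ ∧ 0 < b₃ ∧
      ∀ (Ω : Type*) (_ : MeasurableSpace Ω) (μ : Measure Ω) (_ : IsProbabilityMeasure μ)
        (X : ℕ → Ω → ℝ) (ν : Measure ℝ) (f : ℝ → ℝ) (τ q y : ℝ), 0 ≤ τ → τ ≤ 1 →
        (∀ k, Measurable (X (k + 1))) → iIndepFun (fun k => X (k + 1)) μ →
        (∀ k, μ.map (X (k + 1)) = ν) → HasSmoothDensity ν f cf →
        ν.real (Set.Iic q) = τ → cL ≤ f q → |q| ≤ M → |y| ≤ cy →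
        ∀ n : ℕ, 1 ≤ n → ∀ x : ℝ, 0 < x →
          μ.real {ω | x < |averagedSGD cγ β a τ y (fun t => X t ω) n - q|} ≤
            C * sgdTailBound β b₁ b₂ b₃ n x := by
  have hβ0 : 0 < β := by linarith
  have h1β : 0 < 1 - β := by linarith
  obtain ⟨C, b, hC, hb, htail⟩ := exists_tail_bound hβ hβ' hcγ (half_pos hcL)
    (show 0 < cL / (2 * cf) by positivity) (mul_pos hcf ha)
    (show 0 < cy + M + cγ / (1 - β) by positivity)
  obtain ⟨E, hE⟩ : ∃ E, E = (2 / β + 1 + 2 * (cy + M + cγ / (1 - β))) / cγ + cf / (1 - β)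
      + cf * (cy + M + cγ / (1 - β)) ^ 2 := ⟨_, rfl⟩
  have hEp : 0 < E := by rw [hE]; positivity
  -- `η` makes the summed errors small, `κ` the bias: both are compared with `cL * n * x`
  obtain ⟨η, hη, hη1, hηE⟩ : ∃ η : ℝ, 0 < η ∧ η ≤ 1 ∧ η * E ≤ cL / 4 := by
    refine ⟨min 1 (cL / 4 / E), by positivity, min_le_left _ _, ?_⟩
    rw [← le_div_iff₀ hEp]
    exact min_le_right _ _
  obtain ⟨κ, hκ1, hκ⟩ : ∃ κ : ℝ, 1 ≤ κ ∧ cf * a * (cγ / (1 - β)) ≤ cL / 4 * κ := by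
    refine ⟨max 1 (cf * a * (cγ / (1 - β)) / (cL / 4)), le_max_left _ _, ?_⟩
    have := (div_le_iff₀ (show 0 < cL / 4 by positivity)).1
      (le_max_right 1 (cf * a * (cγ / (1 - β)) / (cL / 4)))
    linarith
  obtain ⟨b₁, hb₁, hb₁1, hb₁2⟩ : ∃ b₁ : ℝ, 0 < b₁ ∧ b₁ ≤ cL ^ 2 / 32 ∧ b₁ ≤ b * η ^ 2 / 2 :=
    ⟨min (cL ^ 2 / 32) (b * η ^ 2 / 2), by positivity, min_le_left _ _, min_le_right _ _⟩
  obtain ⟨C₁, hC₁, hexp⟩ := exists_natCast_rpow_le_mul_exp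
    (show 0 < b * η ^ 2 / 2 by positivity) h1β 2
  refine ⟨Real.exp (b₁ * κ ^ 2) + 1 + 2 + 8 * C * C₁ + 8 * C + 4 * C, b₁, b * η ^ 2 / 2, b * η ^ β,
    by positivity, hb₁, by positivity, by positivity, ?_⟩
  intro Ω _ μ _ X ν f τ q y h0 h1 hXm hind hν H hq hfq hqM hy n hn x hx
  have hnp : (0 : ℝ) < n := by exact_mod_cast hn
  have hn1 : (1 : ℝ) ≤ n := by exact_mod_cast hn
  unfold sgdTailBound
  obtain ⟨T₁, hT₁⟩ : ∃ T, T = Real.exp (-b₁ * n * x ^ 2) := ⟨_, rfl⟩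
  obtain ⟨T₂, hT₂⟩ : ∃ T, T = n * Real.exp (-(b * η ^ 2 / 2) * (n : ℝ) ^ β * x) := ⟨_, rfl⟩
  obtain ⟨T₃, hT₃⟩ : ∃ T, T = (n : ℝ) ^ (2 + β) *
    Real.exp (-(b * η ^ β) * (n : ℝ) ^ (β * (1 - β)) * x ^ (1 / 4 : ℝ)) := ⟨_, rfl⟩
  rw [← hT₁, ← hT₂, ← hT₃]
  have hT₁p : 0 < T₁ := hT₁ ▸ Real.exp_pos _
  have hT₂p : 0 < T₂ := by rw [hT₂]; positivity
  have hT₃p : 0 < T₃ := by rw [hT₃]; positivity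
  have hEκ := Real.exp_pos (b₁ * κ ^ 2)
  have hCC₁ : 0 < 8 * C * C₁ := by positivity
  -- the bound exceeds one unless `n x ^ 2` is large and `T₂ < 1`
  rcases lt_or_ge (x * √n) κ with hnx | hnx
  · refine measureReal_le_one.trans ?_
    have e1 : n * x ^ 2 ≤ κ ^ 2 := by
      have := pow_le_pow_left₀ (by positivity) hnx.le 2
      rw [mul_pow, Real.sq_sqrt hnp.le] at this
      linarith
    have e2 : 1 ≤ Real.exp (b₁ * κ ^ 2) * T₁ := by
      rw [hT₁, ← Real.exp_add]
      have := mul_le_mul_of_nonneg_left e1 hb₁.le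
      exact Real.one_le_exp (by linarith)
    exact e2.trans (mul_le_mul (by linarith) (by linarith) hT₁p.le (by positivity))
  rcases le_or_gt 1 T₂ with hT | hT
  · refine measureReal_le_one.trans ?_
    calc (1 : ℝ) ≤ 1 * T₂ := by linarith
      _ ≤ _ := mul_le_mul (by linarith) (by linarith) hT₂p.le (by positivity)
  have hxn1 : 1 ≤ x * √n := hκ1.trans hnx
  have hnx2 : 1 ≤ n * x ^ 2 := by
    have := one_le_pow₀ hxn1 (n := 2)
    rw [mul_pow, Real.sq_sqrt hnp.le] at this
    linarith
  have hnx1 : 1 ≤ n * x := by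
    calc (1 : ℝ) ≤ x * √n * √n := one_le_mul_of_one_le_of_one_le hxn1 (Real.one_le_sqrt.2 hn1)
      _ = n * x := by rw [mul_assoc, Real.mul_self_sqrt hnp.le, mul_comm]
  have hsx : 0 < √x := Real.sqrt_pos.2 hx
  set ρ := min (η * x * (n : ℝ) ^ (1 - β)) (η * √x) with hρ
  have hmain := measureReal_averagedSGD_le hβ hβ' hcγ ha h0 h1 hcL hcf hM hcy hXm hind hν H hq hfq
    hqM hy hη hη1 (hE ▸ hηE) hκ1 hκ hC hb (htail Ω _ μ inferInstance) hn hx hnx (ρ := ρ)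
    (by rw [hρ]; positivity) (min_le_left _ _) (min_le_right _ _)
  have k1 : Real.exp (-(cL ^ 2 / 32 * (n * x ^ 2))) ≤ T₁ := by
    rw [hT₁, Real.exp_le_exp]
    have := mul_le_mul_of_nonneg_right hb₁1 (by positivity : 0 ≤ n * x ^ 2)
    linarith
  have k3 : n * Real.exp (-(b * (η ^ β * √(n * x) ^ β))) ≤ T₃ := by
    rw [hT₃]
    refine mul_le_mul ?_ ?_ (Real.exp_pos _).le (by positivity)
    · simpa using Real.rpow_le_rpow_of_exponent_le hn1 (by linarith : (1 : ℝ) ≤ 2 + β)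
    · rw [Real.exp_le_exp]
      have := mul_le_mul_of_nonneg_left (rpow_mul_rpow_le_mul_rpow hβ hn hx hnx1)
        (by positivity : 0 ≤ b * η ^ β)
      linarith
  have k2 : n ^ 2 * Real.exp (-(b * (ρ ^ 2 * (n : ℝ) ^ β))) ≤ C₁ * T₁ + T₂ := by
    rcases le_total (η * x * (n : ℝ) ^ (1 - β)) (η * √x) with hle | hle
    · rw [hρ, min_eq_left hle]
      have e1 : (η * x * (n : ℝ) ^ (1 - β)) ^ 2 * (n : ℝ) ^ β
          = η ^ 2 * ((n * x ^ 2) * (n : ℝ) ^ (1 - β)) := by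
        have : (n : ℝ) ^ (1 - β) * (n : ℝ) ^ β = n := by rw [← Real.rpow_add hnp]; simp
        calc _ = η ^ 2 * (((n : ℝ) ^ (1 - β) * (n : ℝ) ^ β) * x ^ 2 * (n : ℝ) ^ (1 - β)) := by ring
          _ = _ := by rw [this]
      have e2 : 1 ≤ (n : ℝ) ^ (1 - β) := Real.one_le_rpow hn1 h1β.le
      have e3 : n * x ^ 2 / 2 + (n : ℝ) ^ (1 - β) / 2 ≤ (n * x ^ 2) * (n : ℝ) ^ (1 - β) := by
        have f1 := le_mul_of_one_le_right (zero_le_one.trans hnx2) e2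
        have f2 := le_mul_of_one_le_left (zero_le_one.trans e2) hnx2
        linarith
      have e4 := mul_le_mul_of_nonneg_left e3 (by positivity : 0 ≤ b * η ^ 2)
      have e5 := mul_le_mul_of_nonneg_right hb₁2 (by positivity : 0 ≤ n * x ^ 2)
      have e6 := hexp n hn
      rw [Real.rpow_two] at e6
      rw [e1]
      calc _ ≤ C₁ * Real.exp (b * η ^ 2 / 2 * (n : ℝ) ^ (1 - β)) *
            Real.exp (-(b * (η ^ 2 * ((n * x ^ 2) * (n : ℝ) ^ (1 - β))))) := by gcongr
        _ ≤ C₁ * T₁ := by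
          rw [mul_assoc, ← Real.exp_add, hT₁]
          gcongr
          linarith
        _ ≤ _ := by linarith
    · rw [hρ, min_eq_right hle, mul_pow, Real.sq_sqrt hx.le]
      -- the prefactor `n ^ 2` is reduced to `n` because `T₂ ^ 2 ≤ T₂`
      have e1 : n ^ 2 * Real.exp (-(b * (η ^ 2 * x * (n : ℝ) ^ β))) = T₂ ^ 2 := by
        rw [hT₂, mul_pow, ← Real.exp_nat_mul]
        congr 2; push_cast; ring
      rw [e1]
      have f1 : 0 < C₁ * T₁ := by positivity
      have f2 := pow_le_of_le_one hT₂p.le hT.le two_ne_zero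
      linarith
  have hA := mul_le_mul_of_nonneg_left k2 (by positivity : 0 ≤ 8 * C)
  have hB := mul_le_mul_of_nonneg_left k3 (by positivity : 0 ≤ 4 * C)
  refine hmain.trans ?_
  have m1 : 0 < Real.exp (b₁ * κ ^ 2) * (T₁ + T₂ + T₃) := by positivity
  have m2 : 0 < 8 * C * C₁ * (T₂ + T₃) := by positivity
  have m3 : 0 < 8 * C * (T₁ + T₃) := by positivity
  have m4 : 0 < 4 * C * (T₁ + T₂) := by positivity
  linarith

/-! ### Uniformity in the quantile level -/

/-- The smoothed SGD is monotone in the quantile level: by `1 / 2 ≤ a`, the smoothed indicator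
has slope at most `1 / γ_k`, so that each update is monotone in the current value. -/
lemma smoothedSGD_mono {cγ β a : ℝ} (hcγ : 0 < cγ) (ha : 1 / 2 ≤ a) (y : ℝ) (x : ℕ → ℝ)
    {τ τ' : ℝ} (h : τ ≤ τ') {k : ℕ} (hk : 1 ≤ k) :
    smoothedSGD cγ β a τ y x k ≤ smoothedSGD cγ β a τ' y x k := by
  induction k, hk using Nat.le_induction with
  | base => exact le_rfl
  | succ k hk ih =>
    rw [smoothedSGD_succ _ _ _ _ _ _ hk, smoothedSGD_succ _ _ _ _ _ _ hk]
    have hg := learningRate_pos (β := β) hcγ hk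
    set γ := learningRate cγ β k
    set Y := smoothedSGD cγ β a τ y x k
    set Y' := smoothedSGD cγ β a τ' y x k
    have hag : 0 < a * γ := mul_pos (by linarith) hg
    have h1 : smoothStepScaled (a * γ) (Y' - x (k + 1)) - smoothStepScaled (a * γ) (Y - x (k + 1))
        ≤ ((Y' - x (k + 1)) / (a * γ) - (Y - x (k + 1)) / (a * γ)) / 2 :=
      smoothStep_sub_le (by gcongr)
    have h2 : γ * (((Y' - x (k + 1)) / (a * γ) - (Y - x (k + 1)) / (a * γ)) / 2)
        = (Y' - Y) / (2 * a) := by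
      have : a ≠ 0 := by linarith
      field_simp
      ring
    have h3 : (Y' - Y) / (2 * a) ≤ Y' - Y := div_le_self (by linarith) (by linarith)
    have h4 := mul_le_mul_of_nonneg_left h1 hg.le
    have h5 := mul_le_mul_of_nonneg_left h hg.le
    linarith

lemma averagedSGD_mono {cγ β a : ℝ} (hcγ : 0 < cγ) (ha : 1 / 2 ≤ a) (y : ℝ) (x : ℕ → ℝ)
    {τ τ' : ℝ} (h : τ ≤ τ') (n : ℕ) :
    averagedSGD cγ β a τ y x n ≤ averagedSGD cγ β a τ' y x n := by
  unfold averagedSGD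
  gcongr with k hk
  exact smoothedSGD_mono hcγ ha y x h (Finset.mem_Icc.1 hk).1

/-- The `j`-th point of the grid of mesh `ε` on `[t₀, t₁]`. -/
noncomputable def gridPoint (t₀ t₁ ε : ℝ) (j : ℕ) : ℝ := min t₁ (t₀ + j * ε)

lemma gridPoint_mem {t₀ t₁ ε : ℝ} (h : t₀ ≤ t₁) (hε : 0 ≤ ε) (j : ℕ) :
    gridPoint t₀ t₁ ε j ∈ Set.Icc t₀ t₁ :=
  ⟨le_min h (by have : (0 : ℝ) ≤ j * ε := by positivity
                linarith), min_le_left _ _⟩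

/-- The difference of two monotone functions, one of which varies by at most `x / 2` between
neighbouring grid points, is controlled by its values on the grid. -/
lemma exists_gridPoint_lt {A Q : ℝ → ℝ} {t₀ t₁ ε x : ℝ} (h : t₀ ≤ t₁) (hε : 0 < ε)
    (hA : ∀ s ∈ Set.Icc t₀ t₁, ∀ t ∈ Set.Icc t₀ t₁, s ≤ t → A s ≤ A t)
    (hQ : ∀ s ∈ Set.Icc t₀ t₁, ∀ t ∈ Set.Icc t₀ t₁, s ≤ t → Q s ≤ Q t)
    (hQε : ∀ s ∈ Set.Icc t₀ t₁, ∀ t ∈ Set.Icc t₀ t₁, s ≤ t → t - s ≤ ε → Q t - Q s ≤ x / 2)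
    {t : ℝ} (ht : t ∈ Set.Icc t₀ t₁) (hx : x < |A t - Q t|) :
    ∃ j ∈ Finset.range (⌈(t₁ - t₀) / ε⌉₊ + 2),
      x / 2 < |A (gridPoint t₀ t₁ ε j) - Q (gridPoint t₀ t₁ ε j)| := by
  set j := ⌊(t - t₀) / ε⌋₊ with hj
  have h0 : 0 ≤ (t - t₀) / ε := div_nonneg (by linarith [ht.1]) hε.le
  have h1 : t₀ + j * ε ≤ t := by
    have := (le_div_iff₀ hε).1 (Nat.floor_le h0)
    linarith
  have h2 : t ≤ t₀ + (j + 1 : ℕ) * ε := by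
    have := (div_lt_iff₀ hε).1 (Nat.lt_floor_add_one ((t - t₀) / ε))
    push_cast
    linarith
  have hjN : j ≤ ⌈(t₁ - t₀) / ε⌉₊ := by
    refine (Nat.floor_le_ceil _).trans (Nat.ceil_mono ?_)
    gcongr
    exact ht.2
  have hs := gridPoint_mem h hε.le j
  have hs' := gridPoint_mem h hε.le (j + 1)
  have h3 : gridPoint t₀ t₁ ε j ≤ t := (min_le_right _ _).trans h1
  have h4 : t ≤ gridPoint t₀ t₁ ε (j + 1) := le_min ht.2 h2
  have h5 : gridPoint t₀ t₁ ε (j + 1) - gridPoint t₀ t₁ ε j ≤ ε := by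
    have h6 : gridPoint t₀ t₁ ε (j + 1) ≤ t₀ + j * ε + ε :=
      (min_le_right _ _).trans_eq (by push_cast; ring)
    rcases min_choice t₁ (t₀ + j * ε) with h7 | h7
    · have : gridPoint t₀ t₁ ε j = t₁ := h7
      rw [this]
      linarith [hs'.2]
    · have : gridPoint t₀ t₁ ε j = t₀ + j * ε := h7
      rw [this]
      linarith
  -- by monotonicity an excess at `t` persists at the right neighbour, a deficit at the left one
  have h6 := hQε _ hs _ hs' (h3.trans h4) h5
  have q1 := hQ _ hs _ ht h3
  have q2 := hQ _ ht _ hs' h4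
  rcases lt_abs.1 hx with h7 | h7
  · refine ⟨j + 1, by simp; omega, lt_abs.2 (Or.inl ?_)⟩
    linarith [hA _ ht _ hs' h4]
  · refine ⟨j, by simp; omega, lt_abs.2 (Or.inr ?_)⟩
    linarith [hA _ hs _ ht h3]

lemma exists_add_one_mul_exp_le {b q : ℝ} (hb : 0 < b) (hq : 0 < q) :
    ∃ C : ℝ, 0 < C ∧ ∀ x s : ℝ, 0 < x → b * x ^ q ≤ s →
      (x + 1) * Real.exp (-(2 * s)) ≤ C * Real.exp (-s) := by
  obtain ⟨C, hC, h⟩ := exists_rpow_le_mul_exp hb (1 / q)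
  refine ⟨2 * C, by linarith, fun x s hx hs => ?_⟩
  have h1 := h (x ^ q) (by positivity) (Or.inr (by positivity))
  rw [← Real.rpow_mul hx.le, mul_one_div_cancel hq.ne', Real.rpow_one] at h1
  have h2 : x + 1 ≤ 2 * C * Real.exp s := by
    have h3 : Real.exp (b * x ^ q) ≤ Real.exp s := Real.exp_le_exp.2 hs
    have h4 : 1 ≤ Real.exp s := Real.one_le_exp (le_trans (by positivity) hs)
    nlinarith
  calc _ ≤ 2 * C * Real.exp s * Real.exp (-(2 * s)) := by gcongr
    _ = _ := by rw [mul_assoc, ← Real.exp_add]; ring_nf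

lemma sgdTailBound_nonneg (β b₁ b₂ b₃ : ℝ) (n : ℕ) (x : ℝ) : 0 ≤ sgdTailBound β b₁ b₂ b₃ n x := by
  unfold sgdTailBound; positivity

/-- Halving `x` and multiplying by `x + 1` is absorbed by smaller constants in the exponents. -/
lemma exists_add_one_mul_sgdTailBound_le {β b₁ b₂ b₃ : ℝ} (hβ : 0 < β) (hβ' : β < 1)
    (hb₁ : 0 < b₁) (hb₂ : 0 < b₂) (hb₃ : 0 < b₃) :
    ∃ C d₁ d₂ d₃ : ℝ, 0 < C ∧ 0 < d₁ ∧ 0 < d₂ ∧ 0 < d₃ ∧ ∀ n : ℕ, 1 ≤ n → ∀ x : ℝ, 0 < x →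
      (x + 1) * sgdTailBound β b₁ b₂ b₃ n (x / 2) ≤ C * sgdTailBound β d₁ d₂ d₃ n x := by
  have h1β : 0 < 1 - β := by linarith
  obtain ⟨C₁, hC₁, h₁⟩ := exists_add_one_mul_exp_le (show 0 < b₁ / 8 by positivity)
    (show (0 : ℝ) < 2 by norm_num)
  obtain ⟨C₂, hC₂, h₂⟩ := exists_add_one_mul_exp_le (show 0 < b₂ / 4 by positivity)
    (show (0 : ℝ) < 1 by norm_num)
  obtain ⟨d, hd⟩ : ∃ d, d = b₃ * (1 / 2) ^ (1 / 4 : ℝ) / 2 := ⟨_, rfl⟩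
  have hdp : 0 < d := by rw [hd]; positivity
  obtain ⟨C₃, hC₃, h₃⟩ := exists_add_one_mul_exp_le hdp (show (0 : ℝ) < 1 / 4 by norm_num)
  refine ⟨C₁ + C₂ + C₃, b₁ / 8, b₂ / 4, d, by positivity, by positivity, by positivity, hdp, ?_⟩
  intro n hn x hx
  have hn1 : (1 : ℝ) ≤ n := by exact_mod_cast hn
  have hnp : (0 : ℝ) < n := by linarith
  have k₁ := h₁ x (b₁ / 8 * n * x ^ 2) hx (by
    rw [Real.rpow_two]
    gcongr
    exact le_mul_of_one_le_right (by positivity) hn1)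
  have k₂ := h₂ x (b₂ / 4 * (n : ℝ) ^ β * x) hx (by
    rw [Real.rpow_one]
    gcongr
    exact le_mul_of_one_le_right (by positivity) (Real.one_le_rpow hn1 hβ.le))
  have k₃ := h₃ x (d * (n : ℝ) ^ (β * (1 - β)) * x ^ (1 / 4 : ℝ)) hx (by
    gcongr
    exact le_mul_of_one_le_right (by positivity) (Real.one_le_rpow hn1 (by positivity)))
  have e₁ : -b₁ * n * (x / 2) ^ 2 = -(2 * (b₁ / 8 * n * x ^ 2)) := by ring
  have e₂ : -b₂ * (n : ℝ) ^ β * (x / 2) = -(2 * (b₂ / 4 * (n : ℝ) ^ β * x)) := by ring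
  have e₃ : -b₃ * (n : ℝ) ^ (β * (1 - β)) * (x / 2) ^ (1 / 4 : ℝ)
      = -(2 * (d * (n : ℝ) ^ (β * (1 - β)) * x ^ (1 / 4 : ℝ))) := by
    rw [div_eq_mul_one_div x 2, Real.mul_rpow hx.le (by norm_num), hd]; ring
  have k₂' := mul_le_mul_of_nonneg_left k₂ hnp.le
  have k₃' := mul_le_mul_of_nonneg_left k₃ (by positivity : 0 ≤ (n : ℝ) ^ (2 + β))
  unfold sgdTailBound
  rw [e₁, e₂, e₃]
  simp only [neg_mul]
  obtain ⟨S₁, hS₁⟩ : ∃ S, S = Real.exp (-(b₁ / 8 * n * x ^ 2)) := ⟨_, rfl⟩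
  obtain ⟨S₂, hS₂⟩ : ∃ S, S = n * Real.exp (-(b₂ / 4 * (n : ℝ) ^ β * x)) := ⟨_, rfl⟩
  obtain ⟨S₃, hS₃⟩ : ∃ S, S = (n : ℝ) ^ (2 + β) *
    Real.exp (-(d * (n : ℝ) ^ (β * (1 - β)) * x ^ (1 / 4 : ℝ))) := ⟨_, rfl⟩
  have p₁ : 0 < S₁ := hS₁ ▸ Real.exp_pos _
  have p₂ : 0 < S₂ := by rw [hS₂]; positivity
  have p₃ : 0 < S₃ := by rw [hS₃]; positivity
  rw [mul_left_comm, mul_left_comm _ C₂, ← hS₂] at k₂'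
  rw [mul_left_comm, mul_left_comm _ C₃, ← hS₃] at k₃'
  rw [← hS₁] at k₁
  rw [← hS₁, ← hS₂, ← hS₃]
  have m₁ : 0 < C₁ * (S₂ + S₃) := by positivity
  have m₂ : 0 < C₂ * (S₁ + S₃) := by positivity
  have m₃ : 0 < C₃ * (S₁ + S₂) := by positivity
  linarith

section Uniform

variable {ν : Measure ℝ} [IsProbabilityMeasure ν] {f : ℝ → ℝ} {cf cL t₀ t₁ : ℝ} {Q : ℝ → ℝ}

lemma quantile_mono (hQ : ∀ t ∈ Set.Icc t₀ t₁, ν.real (Set.Iic (Q t)) = t)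
    {s t : ℝ} (hs : s ∈ Set.Icc t₀ t₁) (ht : t ∈ Set.Icc t₀ t₁) (hst : s ≤ t) : Q s ≤ Q t := by
  by_contra! h
  have h1 : ν.real (Set.Iic (Q t)) ≤ ν.real (Set.Iic (Q s)) := HasSmoothDensity.cdf_mono _ _ h.le
  rw [hQ s hs, hQ t ht] at h1
  rw [le_antisymm hst h1] at h
  exact lt_irrefl _ h

lemma quantile_sub_le (H : HasSmoothDensity ν f cf) (hcf : 0 < cf) (hcL : 0 < cL)
    (hQ : ∀ t ∈ Set.Icc t₀ t₁, ν.real (Set.Iic (Q t)) = t)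
    (hfQ : ∀ t ∈ Set.Icc t₀ t₁, cL ≤ f (Q t)) {s t x : ℝ} (hs : s ∈ Set.Icc t₀ t₁)
    (ht : t ∈ Set.Icc t₀ t₁) (hst : s ≤ t)
    (h : t - s ≤ cL / 2 * min (x / 2) (cL / (2 * cf) / 2)) : Q t - Q s ≤ x / 2 := by
  have h1 := H.le_cdf_sub hcf hcL (hfQ s hs) (quantile_mono hQ hs ht hst)
  rw [hQ s hs, hQ t ht] at h1
  have h2 := le_of_mul_le_mul_left (h1.trans h) (half_pos hcL)
  have h3 : 0 < cL / (2 * cf) := by positivity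
  rcases min_le_iff.1 (h2.trans (min_le_right _ _)) with h4 | h4
  · rw [min_eq_left (by linarith)] at h2
    exact h2.trans (min_le_left _ _)
  · linarith

end Uniform

/-- The tail bound for the averaged smoothed SGD, uniformly over the quantile levels of a compact
interval. -/
theorem exists_averagedSGD_uniform_tail {β cγ a cL cf M cy t₀ t₁ : ℝ}
    (hβ : 1 / 2 < β) (hβ' : β < 1) (hcγ : 0 < cγ) (ha : 1 / 2 < a)
    (hcL : 0 < cL) (hcf : 0 < cf) (hM : 0 < M) (hcy : 0 ≤ cy)
    (ht₀ : 0 < t₀) (ht : t₀ < t₁) (ht₁ : t₁ < 1) :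
    ∃ C b₁ b₂ b₃ : ℝ, 0 < C ∧ 0 < b₁ ∧ 0 < b₂ ∧ 0 < b₃ ∧
      ∀ (Ω : Type*) (_ : MeasurableSpace Ω) (μ : Measure Ω) (_ : IsProbabilityMeasure μ)
        (X : ℕ → Ω → ℝ) (ν : Measure ℝ) (f Q : ℝ → ℝ) (y : ℝ),
        (∀ k, Measurable (X (k + 1))) → iIndepFun (fun k => X (k + 1)) μ →
        (∀ k, μ.map (X (k + 1)) = ν) → HasSmoothDensity ν f cf →
        (∀ τ ∈ Set.Icc t₀ t₁, ν.real (Set.Iic (Q τ)) = τ) →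
        (∀ τ ∈ Set.Icc t₀ t₁, cL ≤ f (Q τ)) → (∀ τ ∈ Set.Icc t₀ t₁, |Q τ| ≤ M) → |y| ≤ cy →
        ∀ n : ℕ, 1 ≤ n → ∀ x : ℝ, 0 < x →
          μ.real {ω | ∃ τ ∈ Set.Icc t₀ t₁,
            x < |averagedSGD cγ β a τ y (fun t => X t ω) n - Q τ|} ≤
            C * (x⁻¹ * sgdTailBound β b₁ b₂ b₃ n x) := by
  obtain ⟨C, b₁, b₂, b₃, hC, hb₁, hb₂, hb₃, hmain⟩ :=
    exists_averagedSGD_tail hβ hβ' hcγ (show 0 < a by linarith) hcL hcf hM hcy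
  obtain ⟨C', d₁, d₂, d₃, hC', hd₁, hd₂, hd₃, hhalf⟩ :=
    exists_add_one_mul_sgdTailBound_le (show 0 < β by linarith) hβ' hb₁ hb₂ hb₃
  obtain ⟨δ, hδ⟩ : ∃ δ, δ = cL / (2 * cf) := ⟨_, rfl⟩
  have hδp : 0 < δ := by rw [hδ]; positivity
  obtain ⟨K, hK⟩ : ∃ K, K = 3 + 4 / cL * (1 + 1 / δ) := ⟨_, rfl⟩
  have hKp : 0 < K := by rw [hK]; positivity
  refine ⟨K * C * C', d₁, d₂, d₃, by positivity, hd₁, hd₂, hd₃, ?_⟩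
  intro Ω _ μ _ X ν f Q y hXm hind hν H hQ hfQ hQM hy n hn x hx
  have hνp : IsProbabilityMeasure ν := hν 0 ▸ Measure.isProbabilityMeasure_map (hXm 0).aemeasurable
  set ε := cL / 2 * min (x / 2) (δ / 2) with hε
  have hεp : 0 < ε := by positivity
  have hsub : {ω | ∃ τ ∈ Set.Icc t₀ t₁,
      x < |averagedSGD cγ β a τ y (fun t => X t ω) n - Q τ|} ⊆
      ⋃ j ∈ Finset.range (⌈(t₁ - t₀) / ε⌉₊ + 2),
        {ω | x / 2 < |averagedSGD cγ β a (gridPoint t₀ t₁ ε j) y (fun t => X t ω) n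
          - Q (gridPoint t₀ t₁ ε j)|} := by
    rintro ω ⟨τ, hτ, hxτ⟩
    obtain ⟨j, hj, hj'⟩ := exists_gridPoint_lt
      (A := fun τ => averagedSGD cγ β a τ y (fun t => X t ω) n) ht.le hεp
      (fun s _ t _ hst => averagedSGD_mono hcγ ha.le _ _ hst n)
      (fun s hs t ht hst => quantile_mono hQ hs ht hst)
      (fun s hs t ht hst h => quantile_sub_le H hcf hcL hQ hfQ hs ht hst (by rw [← hδ]; exact h))
      hτ hxτ
    exact Set.mem_biUnion hj hj'
  have hcount : ((⌈(t₁ - t₀) / ε⌉₊ + 2 : ℕ) : ℝ) ≤ K * (x⁻¹ * (x + 1)) := by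
    have h1 := (Nat.ceil_lt_add_one (div_nonneg (sub_nonneg.2 ht.le) hεp.le)).le
    have h2 : (t₁ - t₀) / ε ≤ 4 / cL * (1 / x + 1 / δ) := by
      rw [div_le_iff₀ hεp, hε]
      rcases min_choice (x / 2) (δ / 2) with h | h <;> rw [h]
      · calc t₁ - t₀ ≤ 1 := by linarith
          _ ≤ 1 + x / δ := by linarith [div_pos hx hδp]
          _ = _ := by field_simp; ring
      · calc t₁ - t₀ ≤ 1 := by linarith
          _ ≤ 1 + δ / x := by linarith [div_pos hδp hx]
          _ = _ := by field_simp; ring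
    have h3 : x⁻¹ * (x + 1) = 1 + 1 / x := by field_simp
    have h4 : 4 / cL * (1 / x + 1 / δ) + 3 ≤ K * (1 + 1 / x) := by
      rw [hK]
      have i1 : 0 < 1 / x := by positivity
      have i2 : 0 < 4 / cL := by positivity
      have i3 : 0 < 1 / δ := by positivity
      have i4 := mul_pos i2 i3
      have i5 := mul_pos i4 i1
      linarith
    rw [h3]
    push_cast
    linarith
  have hT := sgdTailBound_nonneg β b₁ b₂ b₃ n (x / 2)
  calc _ ≤ ∑ j ∈ Finset.range (⌈(t₁ - t₀) / ε⌉₊ + 2), μ.real {ω | x / 2 <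
          |averagedSGD cγ β a (gridPoint t₀ t₁ ε j) y (fun t => X t ω) n
            - Q (gridPoint t₀ t₁ ε j)|} :=
        (measureReal_mono hsub (measure_ne_top _ _)).trans (measureReal_biUnion_finset_le _ _)
    _ ≤ ∑ j ∈ Finset.range (⌈(t₁ - t₀) / ε⌉₊ + 2), C * sgdTailBound β b₁ b₂ b₃ n (x / 2) := by
      refine Finset.sum_le_sum fun j _ => ?_
      have hj := gridPoint_mem ht.le hεp.le j
      exact hmain Ω _ μ inferInstance X ν f _ _ y (by linarith [hj.1]) (by linarith [hj.2])
        hXm hind hν H (hQ _ hj) (hfQ _ hj) (hQM _ hj) hy n hn _ (half_pos hx)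
    _ = ((⌈(t₁ - t₀) / ε⌉₊ + 2 : ℕ) : ℝ) * (C * sgdTailBound β b₁ b₂ b₃ n (x / 2)) := by
      rw [Finset.sum_const, Finset.card_range, nsmul_eq_mul]
    _ ≤ K * (x⁻¹ * (x + 1)) * (C * sgdTailBound β b₁ b₂ b₃ n (x / 2)) := by gcongr
    _ = K * C * (x⁻¹ * ((x + 1) * sgdTailBound β b₁ b₂ b₃ n (x / 2))) := by ring
    _ ≤ K * C * (x⁻¹ * (C' * sgdTailBound β d₁ d₂ d₃ n x)) := by
      gcongr ?_ * (_ * ?_)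
      exact hhalf n hn x hx
    _ = _ := by ring

/-! ### Tail bounds for the averaged smoothed SGD -/

theorem theorem3
    (β cγ a τ₀ τ₁ cL cf M cy : ℝ)
    (hβ : 1 / 2 < β) (hβ' : β < 1) (hcγ : 0 < cγ) (ha : 1 / 2 < a)
    (hτ₀ : 0 < τ₀) (hτ : τ₀ < τ₁) (hτ₁ : τ₁ < 1)
    (hcL : 0 < cL) (hcf : 0 < cf) (hM : 0 < M) :
    ∃ C b₁ b₂ b₃ b₄ b₅ b₆ b₇ b₈ b₉ b₁₀ : ℝ,
      0 < C ∧ 0 < b₁ ∧ 0 < b₂ ∧ 0 < b₃ ∧ 0 < b₄ ∧ 0 < b₅ ∧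
      0 < b₆ ∧ 0 < b₇ ∧ 0 < b₈ ∧ 0 < b₉ ∧ 0 < b₁₀ ∧
      ∀ (p : ℕ) (Ω : Type*) (_ : MeasurableSpace Ω) (μ : Measure Ω) (_ : IsProbabilityMeasure μ)
        -- `W t`, for `t ≥ 1`, is the `t`-th data vector; `W 0` plays no role
        (W : ℕ → Ω → Fin p → ℝ)
        (f Q : Fin p → ℝ → ℝ) (y : Fin p → ℝ),
        (∀ t, 1 ≤ t → Measurable (W t)) →
        iIndepFun (fun k : ℕ => W (k + 1)) μ →
        (∀ t, 1 ≤ t → IdentDistrib (W t) (W 1) μ μ) →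
        -- the `i`-th coordinate has density `f i`
        (∀ i x, 0 ≤ f i x) →
        (∀ i, μ.map (fun ω => W 1 ω i) = volume.withDensity (fun x => ENNReal.ofReal (f i x))) →
        (∀ i, Differentiable ℝ (f i)) →
        (∀ i x, |f i x| ≤ cf) →
        (∀ i x, |deriv (f i) x| ≤ cf) →
        -- `Q i τ` is the `τ`-quantile of the `i`-th coordinate
        (∀ i, ∀ τ ∈ Set.Icc τ₀ τ₁, IsQuantile μ (fun ω => W 1 ω i) τ (Q i τ)) →
        (∀ i, ∀ τ ∈ Set.Icc τ₀ τ₁, cL ≤ f i (Q i τ)) →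
        (∀ i, ∀ τ ∈ Set.Icc τ₀ τ₁, |Q i τ| ≤ M) →
        -- the initial values
        (∀ i, |y i| ≤ cy) →
        ∀ (n : ℕ), 1 ≤ n → ∀ x : ℝ, 0 < x →
          (∀ i, ∀ τ ∈ Set.Icc τ₀ τ₁,
            μ.real {ω | x < |averagedSGD cγ β a τ (y i) (fun t => W t ω i) n - Q i τ|} ≤
              C * (Real.exp (-b₁ * n * x ^ 2)
                + n * Real.exp (-b₂ * (n : ℝ) ^ β * x)
                + (n : ℝ) ^ (2 + β) *
                    Real.exp (-b₃ * (n : ℝ) ^ (β * (1 - β)) * x ^ (1 / 4 : ℝ))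
                + min
                    ((n : ℝ) ^ (2 + β) *
                      Real.exp (-b₄ * (n : ℝ) ^ ((β + 1 / 2) * (1 - β)) * x ^ (1 / 2 : ℝ)))
                    ((n : ℝ) ^ (1 + β) * Real.exp (-b₅ * (n : ℝ) ^ (1 - β ^ 2) * x)))) ∧
          μ.real {ω | ENNReal.ofReal x < ⨆ i : Fin p, ⨆ τ ∈ Set.Icc τ₀ τ₁, ENNReal.ofReal
                |averagedSGD cγ β a τ (y i) (fun t => W t ω i) n - Q i τ|} ≤
            C * (x⁻¹ * p * (Real.exp (-b₆ * n * x ^ 2)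
                + n * Real.exp (-b₇ * (n : ℝ) ^ β * x)
                + (n : ℝ) ^ (2 + β) *
                    Real.exp (-b₈ * (n : ℝ) ^ (β * (1 - β)) * x ^ (1 / 4 : ℝ))
                + min
                    ((n : ℝ) ^ (2 + β) *
                      Real.exp (-b₉ * (n : ℝ) ^ ((β + 1 / 2) * (1 - β)) * x ^ (1 / 2 : ℝ)))
                    ((n : ℝ) ^ (1 + β) * Real.exp (-b₁₀ * (n : ℝ) ^ (1 - β ^ 2) * x)))) := by
  obtain ⟨C, b₁, b₂, b₃, hC, hb₁, hb₂, hb₃, hpoint⟩ :=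
    exists_averagedSGD_tail hβ hβ' hcγ (show 0 < a by linarith) hcL hcf hM (abs_nonneg cy)
  obtain ⟨C', d₁, d₂, d₃, hC', hd₁, hd₂, hd₃, hunif⟩ :=
    exists_averagedSGD_uniform_tail hβ hβ' hcγ ha hcL hcf hM (abs_nonneg cy) hτ₀ hτ hτ₁
  refine ⟨C + C', b₁, b₂, b₃, 1, 1, d₁, d₂, d₃, 1, 1, by positivity, hb₁, hb₂, hb₃, one_pos,
    one_pos, hd₁, hd₂, hd₃, one_pos, one_pos, ?_⟩
  intro p Ω _ μ _ W f Q y hW hind hid hf0 hfd hfdiff hfle hfder hQ hfQ hQM hy n hn x hx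
  have hXm : ∀ i : Fin p, ∀ k, Measurable fun ω => W (k + 1) ω i := fun i k =>
    (measurable_pi_apply i).comp (hW (k + 1) (by omega))
  have hXind : ∀ i : Fin p, iIndepFun (fun k ω => W (k + 1) ω i) μ := fun i =>
    hind.comp (fun _ v => v i) fun _ => measurable_pi_apply i
  have hXν : ∀ i : Fin p, ∀ k, μ.map (fun ω => W (k + 1) ω i) = μ.map fun ω => W 1 ω i :=
    fun i k => ((hid (k + 1) (by omega)).comp (measurable_pi_apply i)).map_eq
  have H : ∀ i : Fin p, HasSmoothDensity (μ.map fun ω => W 1 ω i) (f i) cf := fun i =>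
    ⟨hf0 i, hfd i, hfdiff i, hfle i, hfder i⟩
  have hcdf : ∀ i : Fin p, ∀ τ ∈ Set.Icc τ₀ τ₁,
      (μ.map fun ω => W 1 ω i).real (Set.Iic (Q i τ)) = τ := fun i τ h =>
    (hQ i τ h).cdf_eq (hXm i 0) (H i) (by linarith [h.1]) (by linarith [h.2])
  have hy' : ∀ i, |y i| ≤ |cy| := fun i => (hy i).trans (le_abs_self cy)
  refine ⟨fun i τ h => ?_, ?_⟩
  · refine (hpoint Ω _ μ inferInstance (fun t ω => W t ω i) _ (f i) τ (Q i τ) (y i)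
      (by linarith [h.1]) (by linarith [h.2]) (hXm i) (hXind i) (hXν i) (H i) (hcdf i τ h)
      (hfQ i τ h) (hQM i τ h) (hy' i) n hn x hx).trans ?_
    refine mul_le_mul (by linarith) ?_ (sgdTailBound_nonneg _ _ _ _ _ _) (by positivity)
    rw [sgdTailBound]
    exact le_add_of_nonneg_right (by positivity)
  · have hsub : {ω | ENNReal.ofReal x < ⨆ i : Fin p, ⨆ τ ∈ Set.Icc τ₀ τ₁, ENNReal.ofReal
        |averagedSGD cγ β a τ (y i) (fun t => W t ω i) n - Q i τ|} ⊆
        ⋃ i ∈ (Finset.univ : Finset (Fin p)), {ω | ∃ τ ∈ Set.Icc τ₀ τ₁,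
          x < |averagedSGD cγ β a τ (y i) (fun t => W t ω i) n - Q i τ|} := by
      intro ω hω
      replace hω : ENNReal.ofReal x < ⨆ i : Fin p, ⨆ τ ∈ Set.Icc τ₀ τ₁, ENNReal.ofReal
        |averagedSGD cγ β a τ (y i) (fun t => W t ω i) n - Q i τ| := hω
      simp only [lt_iSup_iff] at hω
      obtain ⟨i, τ, hτi, h⟩ := hω
      exact Set.mem_biUnion (Finset.mem_univ i)
        ⟨τ, hτi, (ENNReal.ofReal_lt_ofReal_iff_of_nonneg hx.le).1 h⟩
    calc _ ≤ ∑ i : Fin p, μ.real {ω | ∃ τ ∈ Set.Icc τ₀ τ₁,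
            x < |averagedSGD cγ β a τ (y i) (fun t => W t ω i) n - Q i τ|} :=
          (measureReal_mono hsub (measure_ne_top _ _)).trans (measureReal_biUnion_finset_le _ _)
      _ ≤ ∑ _i : Fin p, C' * (x⁻¹ * sgdTailBound β d₁ d₂ d₃ n x) :=
        Finset.sum_le_sum fun i _ => hunif Ω _ μ inferInstance (fun t ω => W t ω i) _ (f i) (Q i)
          (y i) (hXm i) (hXind i) (hXν i) (H i) (hcdf i) (hfQ i) (hQM i) (hy' i) n hn x hx
      _ = C' * (x⁻¹ * p * sgdTailBound β d₁ d₂ d₃ n x) := by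
        rw [Finset.sum_const, Finset.card_univ, Fintype.card_fin, nsmul_eq_mul]; ring
      _ ≤ _ := by
        have hT := sgdTailBound_nonneg β d₁ d₂ d₃ n x
        refine mul_le_mul (by linarith) (mul_le_mul_of_nonneg_left ?_ (by positivity))
          (by positivity) (by positivity)
        rw [sgdTailBound]
        exact le_add_of_nonneg_right (by positivity)
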